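/- Consider the Einstein--Vlasov system with Bianchi I symmetry, vanishing cosmological constant and collisionless particles of equal mass $m>0$. The unknowns are $C^\infty$ functions on $[t_0,\infty)$: the spacetime metric is $-dt^2+g_{ab}(t)\,dx^a dx^b$ with $(g_{ab})$ a positive definite $3\times3$ matrix, the second fundamental form is $k_{ab}(t)$, and the particle density is $f(t,p^a)\ge 0$ with finite energy density. With $H=g^{ab}k_{ab}$, $p_a=g_{ab}p^b$, $p^0=(m^2+g^{cd}p_cp_d)^{1/2}$ and $$\rho=\int f\,p^0(\det g)^{-1/2}dp_1dp_2dp_3,\quad S_{ab}=\int f\,\frac{p_ap_b}{p^0}(\det g)^{-1/2}dp_1dp_2dp_3,\quad T_{0a}=-\int f\,p_a(\det g)^{-1/2}dp_1dp_2dp_3,$$ the equations are $$\dot g_{ab}=-2k_{ab},\qquad \dot k_{ab}=Hk_{ab}-2k_{ac}k^c{}_b-8\pi\bigl(S_{ab}-\tfrac12 g_{ab}\,\mathrm{tr}\,S\bigr)-4\pi\rho g_{ab},$$ $$-k_{ab}k^{ab}+H^2=16\pi\rho,\qquad T_{0a}=0,\qquad \frac{\partial f}{\partial t}+2k^a{}_b\,p^b\frac{\partial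 f}{\partial p^a}=0 .$$ Let $\sigma_{ab}=k_{ab}-\tfrac13Hg_{ab}$, $F=\sigma_{ab}\sigma^{ab}/H^2$ and $P(t)=\sup\{(g^{ab}(t)p_ap_b)^{1/2} : f(t,p)\neq0\}\in[0,\infty]$. Theorem. For every $m>0$ there is $\delta>0$ such that every solution on $[t_0,\infty)$ with $H(t_0)\neq0$ (so that $F(t_0)$ is defined), $F(t_0)<\delta$ and $P(t_0)<\delta$ satisfies, as $t\to\infty$, $$H(t)=-2t^{-1}\bigl(1+O(t^{-1})\bigr),\qquad P(t)=O\bigl(t^{-2/3+\varepsilon}\bigr)\ \text{for every } \varepsilon>0,\qquad F(t)=O(t^{-2}).$$ In particular $F(t)\to0$ (the spacetime isotropizes) and $P(t)\to0$ (it becomes dust-like). -/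

import Mathlib

open Filter Topology Asymptotics Set MeasureTheory Matrix
open scoped ContDiff ENNReal

noncomputable section

namespace BianchiI

/-- Real `3 × 3` matrices: the components `A_ab` of a covariant 2-tensor on space. -/
abbrev Mat : Type := Matrix (Fin 3) (Fin 3) ℝ

/-- Components of a spatial vector `p^a` or of a spatial covector `p_a`. -/
abbrev Vec : Type := Fin 3 → ℝ

/-! Algebra with respect to a spatial metric `g_ab`; `g⁻¹` has the components `g^ab`. -/

/-- The trace `g^ab A_ab`. -/
def tr (g A : Mat) : ℝ := ∑ a, ∑ b, g⁻¹ a b * A a b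

/-- The square `A_ab A^ab = g^ac g^bd A_ab A_cd`. -/
def tensorSq (g A : Mat) : ℝ :=
  ∑ a, ∑ b, ∑ c, ∑ d, g⁻¹ a c * g⁻¹ b d * A a b * A c d

/-- The square `g^ab p_a p_b` of a covector. -/
def covSq (g : Mat) (p : Vec) : ℝ := ∑ a, ∑ b, g⁻¹ a b * p a * p b

/-! Matter quantities. The particle density `f` is a function of the contravariant momenta `p^a`,
which are coordinates on the mass shell `-(p^0)^2 + g_ab p^a p^b = -m^2`, `p^0 > 0`.
The integrals are over the covariant components `p_a = g_ab p^b`. -/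

/-- The density `f` as a function of the covariant momenta: `p_a ↦ f (g^ab p_b)`. -/
def inCov (g : Mat) (f : Vec → ℝ) (p : Vec) : ℝ := f (g⁻¹ *ᵥ p)

/-- The particle energy `p^0 = (m^2 + g^cd p_c p_d)^(1/2)`. -/
def energy (m : ℝ) (g : Mat) (p : Vec) : ℝ := √(m ^ 2 + covSq g p)

/-- The energy density `ρ = T^00`. -/
def rho (m : ℝ) (g : Mat) (f : Vec → ℝ) : ℝ :=
  ∫ p : Vec, inCov g f p * energy m g p * (√g.det)⁻¹

/-- The momentum density `T_0a`, where `p_0 = -p^0`. -/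
def mom (g : Mat) (f : Vec → ℝ) (a : Fin 3) : ℝ :=
  -∫ p : Vec, inCov g f p * p a * (√g.det)⁻¹

/-- The spatial stress tensor `S_ab = T_ab`. -/
def stress (m : ℝ) (g : Mat) (f : Vec → ℝ) : Mat :=
  Matrix.of fun a b => ∫ p : Vec, inCov g f p * p a * p b * (energy m g p)⁻¹ * (√g.det)⁻¹

/-! Geometric quantities of a metric `g` and a second fundamental form `k`. -/

/-- `H = tr k` (negative for an expanding spacetime). -/
def H (g k : Mat) : ℝ := tr g k

/-- The trace-free part `σ_ab` of the second fundamental form. -/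
def shear (g k : Mat) : Mat := k - (H g k / 3) • g

/-- `F = σ_ab σ^ab / H^2`. -/
def F (g k : Mat) : ℝ := tensorSq g (shear g k) / H g k ^ 2

/-- `P = sup { (g^ab p_a p_b)^(1/2) | f(p) ≠ 0 }`, with the value `∞` for an unbounded set. -/
def P (g : Mat) (f : Vec → ℝ) : ℝ≥0∞ :=
  ⨆ (p : Vec) (_ : inCov g f p ≠ 0), ENNReal.ofReal √(covSq g p)

/-- Smooth solutions on `[t₀, ∞)`, for particles of mass `m`, of the Einstein-Vlasov system with
Bianchi I symmetry and vanishing cosmological constant: the spacetime metric is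
`-dt^2 + g_ab(t) dx^a dx^b`, the second fundamental form is `k_ab(t)`, and the density of
particles is `f(t, p^a)`. Derivatives at `t₀` are one-sided. -/
structure IsSolution (m t₀ : ℝ) (g k : ℝ → Mat) (f : ℝ → Vec → ℝ) : Prop where
  smooth_g : ∀ a b, ContDiffOn ℝ ∞ (fun t => g t a b) (Ici t₀)
  smooth_k : ∀ a b, ContDiffOn ℝ ∞ (fun t => k t a b) (Ici t₀)
  smooth_f : ContDiffOn ℝ ∞ (fun x : ℝ × Vec => f x.1 x.2) (Ici t₀ ×ˢ univ)
  /-- `g` is symmetric and positive definite. -/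
  posDef : ∀ t ∈ Ici t₀, (g t).PosDef
  f_nonneg : ∀ t ∈ Ici t₀, ∀ p, 0 ≤ f t p
  /-- The energy density is finite. -/
  integrable : ∀ t ∈ Ici t₀,
    Integrable fun p : Vec => inCov (g t) (f t) p * energy m (g t) p * (√(g t).det)⁻¹
  /-- `∂_t g_ab = -2 k_ab`. -/
  evol_g : ∀ t ∈ Ici t₀, ∀ a b,
    HasDerivWithinAt (fun s => g s a b) (-2 * k t a b) (Ici t₀) t
  /-- `∂_t k_ab = H k_ab - 2 k_ac k^c_b - 8π (S_ab - g_ab tr S / 2) - 4π ρ g_ab`. -/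
  evol_k : ∀ t ∈ Ici t₀, ∀ a b,
    HasDerivWithinAt (fun s => k s a b)
      (H (g t) (k t) * k t a b - 2 * (k t * (g t)⁻¹ * k t) a b
        - 8 * Real.pi * (stress m (g t) (f t) a b
            - 1 / 2 * g t a b * tr (g t) (stress m (g t) (f t)))
        - 4 * Real.pi * rho m (g t) (f t) * g t a b) (Ici t₀) t
  /-- `-k_ab k^ab + H^2 = 16π ρ`. -/
  hamiltonian : ∀ t ∈ Ici t₀,
    -tensorSq (g t) (k t) + H (g t) (k t) ^ 2 = 16 * Real.pi * rho m (g t) (f t)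
  /-- `T_0a = 0`. -/
  momentum : ∀ t ∈ Ici t₀, ∀ a, mom (g t) (f t) a = 0
  /-- The Vlasov equation `∂f/∂t + 2 k^a_b p^b ∂f/∂p^a = 0`. -/
  vlasov : ∀ t ∈ Ici t₀, ∀ p : Vec,
    derivWithin (fun s => f s p) (Ici t₀) t
      + ∑ a, 2 * (((g t)⁻¹ * k t) *ᵥ p) a * fderiv ℝ (f t) p (Pi.single a 1) = 0

end BianchiI

end

noncomputable section

namespace BianchiI

/-! The problem reduces to scalar quantities: `h = -H`, the shear ratio `F`, the pressure ratio `s =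
4π tr S / H²`, and `q = g^ab p_a p_b` for each covariant momentum in the support of the density.
Vlasov's equation keeps `p_a` constant along characteristics, so this support does not change with
time and `P² = sup q`. The constraint eliminates `ρ`, and Cauchy-Schwarz bounds the shear terms by
`√F`; the result is the system of differential inequalities `ReducedSystem`. It presupposes `H < 0`:
by the Riccati inequality a contracting solution would end in finite time (`IsSolution.H_neg`).

Dust without shear gives `h = 2/t`, and near it the logarithmic decay rates of `h`, `q`, `F` are
about `h/2`, `2h/3`, `h`. Smallness persists by a first-time argument (`ReducedSystem.F_lt`): while
`F` is small every `q` decreases, so `s` is too small to push `F` up. Since `2/3 > 1/2`, comparison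
with `h` gives the crude bounds `s = O(h)` and `F = O(h)`. These make the corrections to the rates
integrable in time, and the sharp bounds `q = O(h^(4/3))`, `F = O(h²)` follow. Finally `(1/h)' = 1/2
+ 3F/4 + s` has an integrable error, so `1/h - t/2` is bounded, and all rates in `h` become rates in
`t`.

No integral over time is computed. The decreasing function `h` serves as the clock: a rate of size
`u^(6+n)`, where `u = h^(1/6)` and `n > 0`, is dominated by the derivative of a multiple of `-u^n`,
and each estimate is the monotonicity of one explicit function. -/

/-! ### Monotonicity and first-time arguments on a half-line. -/

theorem antitoneOn_Ici_of_hasDerivWithinAt {a : ℝ} {f f' : ℝ → ℝ}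
    (hf : ∀ t ∈ Ici a, HasDerivWithinAt f (f' t) (Ici a) t) (hf' : ∀ t ∈ Ici a, f' t ≤ 0) :
    AntitoneOn f (Ici a) :=
  antitoneOn_of_hasDerivWithinAt_nonpos (convex_Ici a)
    (fun t ht => (hf t ht).continuousWithinAt)
    (fun t ht => (hf t (interior_subset ht)).mono interior_subset)
    (fun t ht => hf' t (interior_subset ht))

theorem antitoneOn_Icc_of_hasDerivWithinAt {a b : ℝ} {f f' : ℝ → ℝ}
    (hf : ∀ t ∈ Ici a, HasDerivWithinAt f (f' t) (Ici a) t) (hf' : ∀ t ∈ Icc a b, f' t ≤ 0) :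
    AntitoneOn f (Icc a b) :=
  antitoneOn_of_hasDerivWithinAt_nonpos (convex_Icc a b)
    (fun t ht => ((hf t ht.1).continuousWithinAt).mono Icc_subset_Ici_self)
    (fun t ht => (hf t (interior_subset ht).1).mono
      (interior_subset.trans Icc_subset_Ici_self))
    (fun t ht => hf' t (interior_subset ht))

/-- A continuous function that starts below `c` stays below `c` if it cannot reach `c` for the
first time. -/
theorem lt_of_forall_first_time_ne {a c : ℝ} {φ : ℝ → ℝ} (hφ : ContinuousOn φ (Ici a))
    (ha : φ a < c) (hne : ∀ b, a < b → (∀ s ∈ Ico a b, φ s < c) → φ b ≠ c) :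
    ∀ t ∈ Ici a, φ t < c := by
  by_contra! hcon
  obtain ⟨t, hta, htc⟩ := hcon
  set S : Set ℝ := Ici a ∩ φ ⁻¹' Ici c with hS
  have hclosed : IsClosed S := hφ.preimage_isClosed_of_isClosed isClosed_Ici isClosed_Ici
  have hbdd : BddBelow S := ⟨a, fun x hx => hx.1⟩
  have hmem : sInf S ∈ S := hclosed.csInf_mem ⟨t, hta, htc⟩ hbdd
  have hlt : ∀ s ∈ Ico a (sInf S), φ s < c := by
    intro s hs
    by_contra! h
    exact absurd (csInf_le hbdd (show s ∈ S from ⟨hs.1, h⟩)) (not_le.2 hs.2)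
  have hab : a < sInf S := by
    refine lt_of_le_of_ne hmem.1 fun h => ?_
    have := hmem.2
    rw [← h] at this
    exact absurd ha (not_lt.2 this)
  refine hne _ hab hlt (le_antisymm ?_ hmem.2)
  have hcont : ContinuousWithinAt φ (Ico a (sInf S)) (sInf S) :=
    (hφ _ hmem.1).mono Ico_subset_Ici_self
  have hcl : sInf S ∈ closure (Ico a (sInf S)) := by
    rw [closure_Ico hab.ne]; exact ⟨hab.le, le_rfl⟩
  exact hcont.closure_le hcl continuousWithinAt_const fun s hs => (hlt s hs).le

/-- At the first time at which a function reaches `c` from below its derivative is nonnegative. -/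
theorem deriv_nonneg_of_first_time {a b c φ' : ℝ} {φ : ℝ → ℝ} (hab : a < b)
    (hd : HasDerivWithinAt φ φ' (Ici a) b) (hlt : ∀ s ∈ Ico a b, φ s < c) (hb : φ b = c) :
    0 ≤ φ' := by
  have h1 : HasDerivWithinAt φ φ' (Ico a b) b := hd.mono Ico_subset_Ici_self
  rw [hasDerivWithinAt_iff_tendsto_slope] at h1
  have : (Ico a b) \ {b} = Ico a b := by
    ext x; simp only [Set.mem_sdiff, mem_Ico, mem_singleton_iff]
    exact ⟨fun h => h.1, fun h => ⟨h, h.2.ne⟩⟩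
  rw [this] at h1
  have : (𝓝[Ico a b] b).NeBot := by
    rw [← mem_closure_iff_nhdsWithin_neBot, closure_Ico hab.ne]; exact ⟨hab.le, le_rfl⟩
  refine ge_of_tendsto h1 ?_
  filter_upwards [self_mem_nhdsWithin] with s hs
  rw [slope_def_field]
  exact div_nonneg_of_nonpos (by linarith [hlt s hs]) (by linarith [hs.2])

/-! ### The scalar system and the persistence of small data. -/

/-- The scalar differential inequalities satisfied by the expansion `h = -H`, the normalized shear
`F`, the normalized trace `s` of the stress tensor, and the squared momenta `q i` of the
particles. -/
structure ReducedSystem {ι : Type*} (m t₀ : ℝ) (h F s : ℝ → ℝ) (q : ι → ℝ → ℝ) : Prop where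
  h_pos : ∀ t ∈ Ici t₀, 0 < h t
  F_nonneg : ∀ t ∈ Ici t₀, 0 ≤ F t
  s_nonneg : ∀ t ∈ Ici t₀, 0 ≤ s t
  q_nonneg : ∀ i, ∀ t ∈ Ici t₀, 0 ≤ q i t
  deriv_h : ∀ t ∈ Ici t₀,
    HasDerivWithinAt h (-(h t ^ 2 * (1 / 2 + 3 / 4 * F t + s t))) (Ici t₀) t
  deriv_F : ∃ F' : ℝ → ℝ, ∀ t ∈ Ici t₀, HasDerivWithinAt F (F' t) (Ici t₀) t ∧
    F' t ≤ -(h t * F t * (1 - 3 / 2 * F t - 2 * s t)) + 4 * s t * √(F t) * h t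
  deriv_q : ∀ i, ∃ q' : ℝ → ℝ, ∀ t ∈ Ici t₀, HasDerivWithinAt (q i) (q' t) (Ici t₀) t ∧
    q' t ≤ -(2 * h t * (1 / 3 - √(F t)) * q i t)
  s_le : ∀ t ∈ Ici t₀, ∀ Q : ℝ, (∀ i, q i t ≤ Q) → 0 ≤ Q → s t ≤ Q / (6 * m ^ 2)

namespace ReducedSystem

variable {ι : Type*} {m t₀ : ℝ} {h F s : ℝ → ℝ} {q : ι → ℝ → ℝ}

theorem sqrt_F_le (hF : ∀ t ∈ Ici t₀, F t ≤ 1 / 10000) : ∀ t ∈ Ici t₀, √(F t) ≤ 1 / 100 := by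
  intro t ht
  rw [show (1 / 100 : ℝ) = √((1 / 100) ^ 2) from (Real.sqrt_sq (by norm_num)).symm]
  exact Real.sqrt_le_sqrt ((hF t ht).trans (by norm_num))

theorem q_antitoneOn_Icc (S : ReducedSystem m t₀ h F s q) {b : ℝ}
    (hF : ∀ t ∈ Icc t₀ b, F t ≤ 1 / 10000) (i : ι) : AntitoneOn (q i) (Icc t₀ b) := by
  obtain ⟨q', hq'⟩ := S.deriv_q i
  refine antitoneOn_Icc_of_hasDerivWithinAt (fun t ht => (hq' t ht).1) fun t ht => ?_
  have h1 : √(F t) ≤ 1 / 100 := by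
    rw [show (1 / 100 : ℝ) = √((1 / 100) ^ 2) from (Real.sqrt_sq (by norm_num)).symm]
    exact Real.sqrt_le_sqrt ((hF t ht).trans (by norm_num))
  have h2 : 0 ≤ 2 * h t * (1 / 3 - √(F t)) * q i t :=
    mul_nonneg (mul_nonneg (by linarith [S.h_pos t ht.1]) (by linarith)) (S.q_nonneg i t ht.1)
  linarith [(hq' t ht.1).2]

/-- Small data stay small. -/
theorem F_lt (S : ReducedSystem m t₀ h F s q) (hm : 0 < m) {δ : ℝ} (hδ : 0 < δ)
    (hδ1 : δ ≤ 1 / 10000) (hδm : δ ≤ m ^ 2 / 10000) (hF : F t₀ < δ) (hq : ∀ i, q i t₀ ≤ δ ^ 2) :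
    ∀ t ∈ Ici t₀, F t < δ := by
  obtain ⟨F', hF'⟩ := S.deriv_F
  refine lt_of_forall_first_time_ne (fun t ht => (hF' t ht).1.continuousWithinAt) hF ?_
  intro b hb hlt hbeq
  have hbmem : b ∈ Ici t₀ := hb.le
  have hle : ∀ t ∈ Icc t₀ b, F t ≤ 1 / 10000 := by
    intro t ht
    rcases ht.2.eq_or_lt with h1 | h1
    · rw [h1, hbeq]; exact hδ1
    · exact (hlt t ⟨ht.1, h1⟩).le.trans hδ1
  have hqb : ∀ i, q i b ≤ δ ^ 2 := fun i =>
    (S.q_antitoneOn_Icc hle i ⟨le_rfl, hb.le⟩ ⟨hb.le, le_rfl⟩ hb.le).trans (hq i)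
  have hs := S.s_le b hbmem _ hqb (by positivity)
  -- The bound `δ² / (6m²)` is quadratic in `δ`; one factor is spent on `δ ≤ m² / 10000`.
  have hs' : s b ≤ δ / 60000 := by
    refine hs.trans ?_
    rw [div_le_div_iff₀ (by positivity) (by norm_num)]
    nlinarith
  have h0 := deriv_nonneg_of_first_time hb (hF' b hbmem).1 hlt hbeq
  have h1 := (hF' b hbmem).2
  rw [hbeq] at h1
  have hsq : √δ ≤ 1 := Real.sqrt_le_one.2 (by linarith)
  have hh := S.h_pos b hbmem
  have hs0 := S.s_nonneg b hbmem
  -- At `F = δ` the source is at most `hδ/4` and the damping at least `hδ/2`, so `F' < 0`, which is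
  -- impossible at a first crossing.
  have h3 : 4 * s b * √δ ≤ δ / 4 := by nlinarith [Real.sqrt_nonneg δ]
  have h4 : δ / 2 ≤ δ * (1 - 3 / 2 * δ - 2 * s b) := by nlinarith
  nlinarith

end ReducedSystem

/-! ### Decay rates of the scalar system, from crude to sharp. -/

namespace ReducedSystem

variable {ι : Type*} {m t₀ : ℝ} {h F s : ℝ → ℝ} {q : ι → ℝ → ℝ}

theorem s_le_of_q_le (S : ReducedSystem m t₀ h F s q) (hm : 0 < m) {δ : ℝ} (hδ : 0 < δ)
    (hδm : δ ≤ m ^ 2 / 10000) (hδ1 : δ ≤ 1 / 10000) (hF : ∀ t ∈ Ici t₀, F t ≤ 1 / 10000)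
    (hq : ∀ i, q i t₀ ≤ δ ^ 2) : ∀ t ∈ Ici t₀, s t ≤ 1 / 1000 := by
  intro t ht
  have hqb : ∀ i, q i t ≤ δ ^ 2 := fun i =>
    (S.q_antitoneOn_Icc (fun x hx => hF x hx.1) i ⟨le_rfl, ht⟩ ⟨ht, le_rfl⟩ ht).trans (hq i)
  refine (S.s_le t ht _ hqb (by positivity)).trans ?_
  rw [div_le_div_iff₀ (by positivity) (by norm_num)]
  nlinarith

theorem h_antitoneOn (S : ReducedSystem m t₀ h F s q) : AntitoneOn h (Ici t₀) := by
  refine antitoneOn_Ici_of_hasDerivWithinAt S.deriv_h fun t ht => ?_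
  have := S.F_nonneg t ht
  have := S.s_nonneg t ht
  have : 0 ≤ h t ^ 2 * (1 / 2 + 3 / 4 * F t + s t) := by positivity
  linarith

/-- The logarithmic decay rate of `q` is near `2h/3` and that of `h` near `h/2`; the gap survives
small `F` and `s`. -/
theorem q_div_h_antitoneOn (S : ReducedSystem m t₀ h F s q)
    (hF : ∀ t ∈ Ici t₀, F t ≤ 1 / 10000) (hs : ∀ t ∈ Ici t₀, s t ≤ 1 / 1000) (i : ι) :
    AntitoneOn (fun t => q i t / h t) (Ici t₀) := by
  obtain ⟨q', hq'⟩ := S.deriv_q i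
  refine antitoneOn_Ici_of_hasDerivWithinAt
    (fun t ht => (hq' t ht).1.fun_div (S.deriv_h t ht) (S.h_pos t ht).ne') fun t ht => ?_
  have hh := S.h_pos t ht
  have h1 := sqrt_F_le hF t ht
  have h2 := (hq' t ht).2
  have h3 := hF t ht
  have h4 := hs t ht
  have h5 := S.q_nonneg i t ht
  refine div_nonpos_of_nonpos_of_nonneg ?_ (by positivity)
  have h6 : 0 ≤ h t ^ 2 * q i t * (2 * (1 / 3 - √(F t)) - (1 / 2 + 3 / 4 * F t + s t)) :=
    mul_nonneg (by positivity) (by linarith)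
  nlinarith [mul_le_mul_of_nonneg_right h2 hh.le]

theorem s_le_mul_h (S : ReducedSystem m t₀ h F s q) (hm : 0 < m) {Q : ℝ} (hQ : 0 ≤ Q)
    (hF : ∀ t ∈ Ici t₀, F t ≤ 1 / 10000) (hs : ∀ t ∈ Ici t₀, s t ≤ 1 / 1000)
    (hq : ∀ i, q i t₀ ≤ Q) : ∃ c : ℝ, 0 ≤ c ∧ ∀ t ∈ Ici t₀, s t ≤ c * h t := by
  have h0 := S.h_pos t₀ self_mem_Ici
  refine ⟨Q / h t₀ / (6 * m ^ 2), by positivity, fun t ht => ?_⟩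
  have hh := S.h_pos t ht
  have hqt : ∀ i, q i t ≤ Q / h t₀ * h t := by
    intro i
    have h1 : q i t / h t ≤ q i t₀ / h t₀ :=
      S.q_div_h_antitoneOn hF hs i self_mem_Ici ht ht
    have h2 : q i t₀ / h t₀ ≤ Q / h t₀ := div_le_div_of_nonneg_right (hq i) h0.le
    rw [← div_le_iff₀ hh]
    exact h1.trans h2
  refine (S.s_le t ht _ hqt (by positivity)).trans (le_of_eq ?_)
  ring

/-- The damping of `F` exceeds the decay rate of `h` by about `h/2`. Half of this gap absorbs the
`F/4` from the source; the remaining `16 s² ≤ 16 c² h²` is compensated by `32 c² h`, whose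
derivative is at most `-16 c² h²`. -/
theorem F_le_mul_h (S : ReducedSystem m t₀ h F s q)
    (hF : ∀ t ∈ Ici t₀, F t ≤ 1 / 10000) (hs : ∀ t ∈ Ici t₀, s t ≤ 1 / 1000)
    {c : ℝ} (hc : ∀ t ∈ Ici t₀, s t ≤ c * h t) :
    ∃ C : ℝ, 0 ≤ C ∧ ∀ t ∈ Ici t₀, F t ≤ C * h t := by
  obtain ⟨F', hF'⟩ := S.deriv_F
  have hanti : AntitoneOn (fun t => F t / h t + 32 * c ^ 2 * h t) (Ici t₀) := by
    refine antitoneOn_Ici_of_hasDerivWithinAt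
      (fun t ht => ((hF' t ht).1.fun_div (S.deriv_h t ht) (S.h_pos t ht).ne').fun_add
        ((S.deriv_h t ht).const_mul (32 * c ^ 2))) fun t ht => ?_
    have hh := S.h_pos t ht
    have h1 := (hF' t ht).2
    have h3 := hF t ht
    have h4 := hs t ht
    have h5 := hc t ht
    have h6 := S.F_nonneg t ht
    have h7 := S.s_nonneg t ht
    -- Young's inequality for the product of `4s` and `√F / 2`.
    have h8 : 4 * s t * √(F t) ≤ 16 * s t ^ 2 + F t / 4 := by
      nlinarith [Real.sq_sqrt h6, sq_nonneg (4 * s t - √(F t) / 2)]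
    have h9 : s t ^ 2 ≤ c ^ 2 * h t ^ 2 := by
      rw [← mul_pow]; exact pow_le_pow_left₀ h7 h5 2
    have key : (F' t * h t - F t * -(h t ^ 2 * (1 / 2 + 3 / 4 * F t + s t))) / h t ^ 2
        ≤ F t * (-1 + 3 / 2 * F t + 2 * s t + 1 / 4 + 1 / 2 + 3 / 4 * F t + s t)
          + 16 * (c ^ 2 * h t ^ 2) := by
      rw [div_le_iff₀ (by positivity)]
      have e1 := mul_le_mul_of_nonneg_right h1 hh.le
      have e2 := mul_le_mul_of_nonneg_right (h8.trans
        (add_le_add_left (mul_le_mul_of_nonneg_left h9 (by norm_num : (0:ℝ) ≤ 16)) _))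
        (by positivity : 0 ≤ h t ^ 2)
      linarith
    have h10 : F t * (-1 + 3 / 2 * F t + 2 * s t + 1 / 4 + 1 / 2 + 3 / 4 * F t + s t) ≤ 0 :=
      mul_nonpos_of_nonneg_of_nonpos h6 (by linarith)
    have h11 : 0 ≤ c ^ 2 * h t ^ 2 * (3 / 4 * F t + s t) := by positivity
    linarith
  have h0 := S.h_pos t₀ self_mem_Ici
  have hF0 := S.F_nonneg t₀ self_mem_Ici
  refine ⟨F t₀ / h t₀ + 32 * c ^ 2 * h t₀, by positivity, fun t ht => ?_⟩
  have hh := S.h_pos t ht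
  have := hanti self_mem_Ici ht ht
  rw [← div_le_iff₀ hh]
  have h2 : 0 ≤ 32 * c ^ 2 * h t := by positivity
  simp only at this
  linarith

/-- The sixth root of `h`, in terms of which all rates are integral powers. -/
theorem exists_sixth_root (S : ReducedSystem m t₀ h F s q) :
    ∃ u : ℝ → ℝ, (∀ t ∈ Ici t₀, 0 < u t) ∧ (∀ t ∈ Ici t₀, h t = u t ^ 6) ∧
      (∀ t ∈ Ici t₀, u t ≤ u t₀) ∧
      ∀ t ∈ Ici t₀, HasDerivWithinAt u
        (-(u t ^ 7 * ((1 / 2 + 3 / 4 * F t + s t) / 6))) (Ici t₀) t := by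
  have hu : ∀ t ∈ Ici t₀, h t = (h t ^ (1 / 6 : ℝ)) ^ 6 := by
    intro t ht
    rw [← Real.rpow_natCast, ← Real.rpow_mul (S.h_pos t ht).le]
    norm_num
  have hpos : ∀ t ∈ Ici t₀, 0 < h t ^ (1 / 6 : ℝ) := fun t ht =>
    Real.rpow_pos_of_pos (S.h_pos t ht) _
  refine ⟨fun t => h t ^ (1 / 6 : ℝ), hpos, hu, fun t ht => ?_, fun t ht => ?_⟩
  · exact Real.rpow_le_rpow (S.h_pos t ht).le (S.h_antitoneOn self_mem_Ici ht ht) (by norm_num)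
  · refine ((S.deriv_h t ht).rpow_const (Or.inl (S.h_pos t ht).ne')).congr_deriv ?_
    have h1 : h t ^ ((1 / 6 : ℝ) - 1) = h t ^ (1 / 6 : ℝ) / h t := by
      rw [Real.rpow_sub (S.h_pos t ht), Real.rpow_one]
    simp only
    rw [h1]
    have h2 := hu t ht
    have h3 := hpos t ht
    set v := h t ^ (1 / 6 : ℝ)
    rw [h2]
    field_simp

/-- In the logarithmic derivative of `q / u^8` the leading terms `∓2h/3` cancel, leaving at most `h
(2√F + F + 4s/3)`. By the crude bounds this is at most `K u^9 / 4`, which the integrating factor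
`exp (K u^3)` absorbs. -/
theorem q_le_pow (S : ReducedSystem m t₀ h F s q) (hs : ∀ t ∈ Ici t₀, s t ≤ 1 / 1000)
    (hF : ∀ t ∈ Ici t₀, F t ≤ 1 / 10000) {u : ℝ → ℝ} (hu : ∀ t ∈ Ici t₀, 0 < u t)
    (hhu : ∀ t ∈ Ici t₀, h t = u t ^ 6)
    (hu' : ∀ t ∈ Ici t₀, HasDerivWithinAt u
        (-(u t ^ 7 * ((1 / 2 + 3 / 4 * F t + s t) / 6))) (Ici t₀) t)
    {c C Q : ℝ} (hQ : 0 ≤ Q) (hc : ∀ t ∈ Ici t₀, s t ≤ c * h t)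
    (hC : ∀ t ∈ Ici t₀, F t ≤ C * h t) (hq : ∀ i, q i t₀ ≤ Q) :
    ∃ D : ℝ, 0 ≤ D ∧ ∀ i, ∀ t ∈ Ici t₀, q i t ≤ D * u t ^ 8 := by
  set K : ℝ := 4 * (3 * √C + 2 * √c) with hK
  have hK0 : 0 ≤ K := by positivity
  have hu00 := hu t₀ self_mem_Ici
  have hsqrt : ∀ {x b y : ℝ}, 0 ≤ x → 0 < y → x ≤ b * y ^ 6 → √x ≤ √b * y ^ 3 := by
    intro x b y hx hy hxy
    have : √(b * y ^ 6) = √b * y ^ 3 := by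
      rw [Real.sqrt_mul' _ (by positivity), show y ^ 6 = (y ^ 3) ^ 2 by ring,
        Real.sqrt_sq (by positivity)]
    rw [← this]
    exact Real.sqrt_le_sqrt hxy
  have hanti : ∀ i, AntitoneOn (fun t => q i t / u t ^ 8 * Real.exp (K * u t ^ 3)) (Ici t₀) := by
    intro i
    obtain ⟨q', hq'⟩ := S.deriv_q i
    refine antitoneOn_Ici_of_hasDerivWithinAt
      (fun t ht => ((hq' t ht).1.fun_div ((hu' t ht).fun_pow 8)
        (pow_ne_zero 8 (hu t ht).ne')).fun_mul
          (((hu' t ht).fun_pow 3).const_mul K).exp) fun t ht => ?_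
    have hut := hu t ht
    have h1 := (hq' t ht).2
    have h2 := S.F_nonneg t ht
    have h3 := S.s_nonneg t ht
    have h4 := S.q_nonneg i t ht
    have hFs : √(F t) ≤ √C * u t ^ 3 := hsqrt h2 hut (hhu t ht ▸ hC t ht)
    have hss : √(s t) ≤ √c * u t ^ 3 := hsqrt h3 hut (hhu t ht ▸ hc t ht)
    have hF1 : F t ≤ √(F t) := by
      have : √(F t) ≤ 1 := Real.sqrt_le_one.2 ((hF t ht).trans (by norm_num))
      nlinarith [Real.sq_sqrt h2, Real.sqrt_nonneg (F t)]
    -- Weakening `F` and `s` to their square roots puts every correction on the common scale `u^3`.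
    have hs1 : s t ≤ √(s t) := by
      have : √(s t) ≤ 1 := Real.sqrt_le_one.2 ((hs t ht).trans (by norm_num))
      nlinarith [Real.sq_sqrt h3, Real.sqrt_nonneg (s t)]
    have hsum : 2 * √(F t) + F t + 4 / 3 * s t ≤ K * u t ^ 3 / 4 := by
      have : K * u t ^ 3 / 4 = 3 * (√C * u t ^ 3) + 2 * (√c * u t ^ 3) := by rw [hK]; ring
      rw [this]
      nlinarith [Real.sqrt_nonneg (s t)]
    have hsum' : 2 * √(F t) + F t + 4 / 3 * s t
        - 3 * K * u t ^ 3 * ((1 / 2 + 3 / 4 * F t + s t) / 6) ≤ 0 := by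
      have : 0 ≤ K * u t ^ 3 * (3 / 4 * F t + s t) := by positivity
      linarith
    rw [hhu t ht] at h1
    have hfin : (q' t + 8 * q i t * u t ^ 6 * ((1 / 2 + 3 / 4 * F t + s t) / 6)
        - q i t * (3 * K * u t ^ 9 * ((1 / 2 + 3 / 4 * F t + s t) / 6))) ≤ 0 := by
      have : 0 ≤ q i t * u t ^ 6 * -(2 * √(F t) + F t + 4 / 3 * s t
        - 3 * K * u t ^ 3 * ((1 / 2 + 3 / 4 * F t + s t) / 6)) :=
        mul_nonneg (by positivity) (by linarith)
      linarith
    have hexp := Real.exp_pos (K * u t ^ 3)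
    refine le_trans (le_of_eq ?_) (mul_nonpos_of_nonneg_of_nonpos
      (by positivity : 0 ≤ Real.exp (K * u t ^ 3) / u t ^ 8) hfin)
    field_simp
    push_cast
    ring
  refine ⟨Q / u t₀ ^ 8 * Real.exp (K * u t₀ ^ 3), by positivity, fun i t ht => ?_⟩
  have hut := hu t ht
  have h1 : q i t / u t ^ 8 * Real.exp (K * u t ^ 3)
    ≤ q i t₀ / u t₀ ^ 8 * Real.exp (K * u t₀ ^ 3) := hanti i self_mem_Ici ht ht
  have h2 : q i t₀ / u t₀ ^ 8 * Real.exp (K * u t₀ ^ 3)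
      ≤ Q / u t₀ ^ 8 * Real.exp (K * u t₀ ^ 3) := by
    gcongr; exact hq i
  have h3 : q i t / u t ^ 8 ≤ q i t / u t ^ 8 * Real.exp (K * u t ^ 3) :=
    le_mul_of_one_le_right (div_nonneg (S.q_nonneg i t ht) (by positivity))
      (Real.one_le_exp (by positivity))
  rw [← div_le_iff₀ (by positivity)]
  linarith

/-- For `G = F / u^12` the damping of `F` cancels the leading decay of `u^12`. The source
contributes a multiple of `√G`, so Gronwall is applied to `1 + G`: its derivative is at most `A u^8
(1 + G)`, absorbed by `exp (6 A u^2)`. -/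
theorem F_le_pow (S : ReducedSystem m t₀ h F s q) {u : ℝ → ℝ} (hu : ∀ t ∈ Ici t₀, 0 < u t)
    (hhu : ∀ t ∈ Ici t₀, h t = u t ^ 6) (hu0 : ∀ t ∈ Ici t₀, u t ≤ u t₀)
    (hu' : ∀ t ∈ Ici t₀, HasDerivWithinAt u
        (-(u t ^ 7 * ((1 / 2 + 3 / 4 * F t + s t) / 6))) (Ici t₀) t)
    {c C D : ℝ} (hc0 : 0 ≤ c) (hC0 : 0 ≤ C) (hD0 : 0 ≤ D) (hc : ∀ t ∈ Ici t₀, s t ≤ c * h t)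
    (hC : ∀ t ∈ Ici t₀, F t ≤ C * h t) (hD : ∀ t ∈ Ici t₀, s t ≤ D * u t ^ 8) :
    ∃ E : ℝ, 0 ≤ E ∧ ∀ t ∈ Ici t₀, F t ≤ E * u t ^ 12 := by
  obtain ⟨F', hF'⟩ := S.deriv_F
  have hu00 := hu t₀ self_mem_Ici
  set A : ℝ := (3 * C + 4 * c) * u t₀ ^ 4 + 4 * D with hA
  have hA0 : 0 ≤ A := by positivity
  have hanti : AntitoneOn (fun t => (1 + F t / u t ^ 12) * Real.exp (6 * A * u t ^ 2))
      (Ici t₀) := by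
    refine antitoneOn_Ici_of_hasDerivWithinAt
      (fun t ht => (((hF' t ht).1.fun_div ((hu' t ht).fun_pow 12)
        (pow_ne_zero 12 (hu t ht).ne')).const_add 1).fun_mul
          (((hu' t ht).fun_pow 2).const_mul (6 * A)).exp) fun t ht => ?_
    have hut := hu t ht
    have h1 := (hF' t ht).2
    have h2 := S.F_nonneg t ht
    have h3 := S.s_nonneg t ht
    rw [hhu t ht] at h1
    -- This is `√G ≤ 1 + G`, scaled by `u^6`.
    have hsqrt : √(F t) ≤ u t ^ 6 * (1 + F t / u t ^ 12) := by
      refine Real.sqrt_le_iff.2 ⟨by positivity, ?_⟩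
      have hx : 0 ≤ F t / u t ^ 12 := by positivity
      have e : F t = u t ^ 12 * (F t / u t ^ 12) := by field_simp
      have : u t ^ 12 * (F t / u t ^ 12) ≤ u t ^ 12 * (1 + F t / u t ^ 12) ^ 2 := by
        gcongr; nlinarith
      calc F t = u t ^ 12 * (F t / u t ^ 12) := e
        _ ≤ _ := this
        _ = _ := by ring
    have hu4 : u t ^ 6 ≤ u t₀ ^ 4 * u t ^ 2 := by
      rw [show u t ^ 6 = u t ^ 4 * u t ^ 2 by ring]
      gcongr
      exact hu0 t ht
    have hFs : 3 * F t + 4 * s t ≤ (3 * C + 4 * c) * u t₀ ^ 4 * u t ^ 2 := by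
      have a1 := hC t ht
      have a2 := hc t ht
      rw [hhu t ht] at a1 a2
      nlinarith [mul_le_mul_of_nonneg_left hu4 (by positivity : 0 ≤ 3 * C + 4 * c)]
    set G := F t / u t ^ 12 with hG
    have hG0 : 0 ≤ G := by positivity
    have hFG : F t = G * u t ^ 12 := by rw [hG]; field_simp
    have hterm1 : u t ^ 6 * F t * (3 * F t + 4 * s t)
        ≤ (3 * C + 4 * c) * u t₀ ^ 4 * u t ^ 8 * u t ^ 12 * (1 + G) := by
      calc u t ^ 6 * F t * (3 * F t + 4 * s t)
          ≤ u t ^ 6 * F t * ((3 * C + 4 * c) * u t₀ ^ 4 * u t ^ 2) := by gcongr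
        _ = (3 * C + 4 * c) * u t₀ ^ 4 * u t ^ 8 * u t ^ 12 * G := by rw [hFG]; ring
        _ ≤ _ := by gcongr; linarith
    have hterm2 : 4 * s t * √(F t) * u t ^ 6 ≤ 4 * D * u t ^ 8 * u t ^ 12 * (1 + G) := by
      calc 4 * s t * √(F t) * u t ^ 6
          ≤ 4 * (D * u t ^ 8) * (u t ^ 6 * (1 + G)) * u t ^ 6 := by
            gcongr; exact hD t ht
        _ = _ := by ring
    have hsum : F' t + 12 * F t * u t ^ 6 * ((1 / 2 + 3 / 4 * F t + s t) / 6)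
        ≤ A * u t ^ 8 * u t ^ 12 * (1 + G) := by
      rw [hA]; linarith
    have hw : A * u t ^ 8 * u t ^ 12 * (1 + G)
        ≤ (1 + G) * u t ^ 12 * (12 * A * u t ^ 8 * ((1 / 2 + 3 / 4 * F t + s t) / 6)) := by
      have : 0 ≤ (1 + G) * u t ^ 12 * (A * u t ^ 8 * (3 / 4 * F t + s t)) := by positivity
      linarith
    have hfin : F' t + 12 * F t * u t ^ 6 * ((1 / 2 + 3 / 4 * F t + s t) / 6)
        - (1 + G) * u t ^ 12 * (12 * A * u t ^ 8 * ((1 / 2 + 3 / 4 * F t + s t) / 6)) ≤ 0 := by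
      linarith
    have hexp := Real.exp_pos (6 * A * u t ^ 2)
    refine le_trans (le_of_eq ?_) (mul_nonpos_of_nonneg_of_nonpos
      (by positivity : 0 ≤ Real.exp (6 * A * u t ^ 2) / u t ^ 12) hfin)
    rw [hG]
    field_simp
    push_cast
    ring
  have hF0 := S.F_nonneg t₀ self_mem_Ici
  refine ⟨(1 + F t₀ / u t₀ ^ 12) * Real.exp (6 * A * u t₀ ^ 2), by positivity, fun t ht => ?_⟩
  have hut := hu t ht
  have h1 : (1 + F t / u t ^ 12) * Real.exp (6 * A * u t ^ 2) ≤
    (1 + F t₀ / u t₀ ^ 12) * Real.exp (6 * A * u t₀ ^ 2) := hanti self_mem_Ici ht ht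
  have hG0 : 0 ≤ F t / u t ^ 12 := div_nonneg (S.F_nonneg t ht) (by positivity)
  have h3 : 1 + F t / u t ^ 12 ≤ (1 + F t / u t ^ 12) * Real.exp (6 * A * u t ^ 2) :=
    le_mul_of_one_le_right (by positivity) (Real.one_le_exp (by positivity))
  rw [← div_le_iff₀ (by positivity)]
  linarith

/-- The derivative of `1/h - t/2` is `3F/4 + s`, between `0` and `A u^8`. The function is therefore
nondecreasing, and becomes nonincreasing after adding `6 A u^2`, whose derivative is at most `-A
u^8`. -/
theorem abs_inv_h_sub_le (S : ReducedSystem m t₀ h F s q) {u : ℝ → ℝ}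
    (hu : ∀ t ∈ Ici t₀, 0 < u t)
    (hu0 : ∀ t ∈ Ici t₀, u t ≤ u t₀)
    (hu' : ∀ t ∈ Ici t₀, HasDerivWithinAt u
        (-(u t ^ 7 * ((1 / 2 + 3 / 4 * F t + s t) / 6))) (Ici t₀) t)
    {D E : ℝ} (hD0 : 0 ≤ D) (hE0 : 0 ≤ E) (hD : ∀ t ∈ Ici t₀, s t ≤ D * u t ^ 8)
    (hE : ∀ t ∈ Ici t₀, F t ≤ E * u t ^ 12) :
    ∃ B : ℝ, ∀ t ∈ Ici t₀, |(h t)⁻¹ - t / 2| ≤ B := by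
  have hu00 := hu t₀ self_mem_Ici
  set A : ℝ := 3 / 4 * E * u t₀ ^ 4 + D with hA
  have hA0 : 0 ≤ A := by positivity
  have hR : ∀ t ∈ Ici t₀, HasDerivWithinAt (fun t => (h t)⁻¹ - t / 2)
      (3 / 4 * F t + s t) (Ici t₀) t := by
    intro t ht
    have hh := S.h_pos t ht
    refine (((S.deriv_h t ht).fun_inv hh.ne').fun_sub
      ((hasDerivWithinAt_id t _).div_const 2)).congr_deriv ?_
    field_simp
    ring
  have hanti : AntitoneOn (fun t => (h t)⁻¹ - t / 2 + 6 * A * u t ^ 2) (Ici t₀) := by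
    refine antitoneOn_Ici_of_hasDerivWithinAt
      (fun t ht => (hR t ht).fun_add (((hu' t ht).fun_pow 2).const_mul (6 * A))) fun t ht => ?_
    have hut := hu t ht
    have h2 := S.F_nonneg t ht
    have h3 := S.s_nonneg t ht
    have h4 := hD t ht
    have h5 : F t ≤ E * u t₀ ^ 4 * u t ^ 8 := by
      refine (hE t ht).trans ?_
      rw [show E * u t ^ 12 = E * u t ^ 4 * u t ^ 8 by ring]
      gcongr
      exact hu0 t ht
    have h6 : 3 / 4 * F t + s t ≤ A * u t ^ 8 := by rw [hA]; linarith
    have h7 : 0 ≤ A * u t ^ 8 * (3 / 4 * F t + s t) := by positivity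
    push_cast
    linarith
  have hmono : AntitoneOn (fun t => -((h t)⁻¹ - t / 2)) (Ici t₀) := by
    refine antitoneOn_Ici_of_hasDerivWithinAt (fun t ht => (hR t ht).fun_neg) fun t ht => ?_
    linarith [S.F_nonneg t ht, S.s_nonneg t ht]
  refine ⟨|(h t₀)⁻¹ - t₀ / 2| + 6 * A * u t₀ ^ 2, fun t ht => ?_⟩
  have h1 := hanti self_mem_Ici ht ht
  have h2 := hmono self_mem_Ici ht ht
  have h3 : 0 ≤ 6 * A * u t ^ 2 := by positivity
  have h4 : 0 ≤ 6 * A * u t₀ ^ 2 := by positivity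
  simp only at h1 h2
  rw [abs_le]
  constructor
  · linarith [neg_abs_le ((h t₀)⁻¹ - t₀ / 2)]
  · linarith [le_abs_self ((h t₀)⁻¹ - t₀ / 2)]

/-- Decay rates of a reduced system with small data. -/
theorem decay (S : ReducedSystem m t₀ h F s q) (hm : 0 < m) {δ : ℝ} (hδ : 0 < δ)
    (hδ1 : δ ≤ 1 / 10000) (hδm : δ ≤ m ^ 2 / 10000) (hF₀ : F t₀ < δ) (hq : ∀ i, q i t₀ ≤ δ ^ 2) :
    ∃ B D E : ℝ, 0 ≤ D ∧ 0 ≤ E ∧ ∀ t ∈ Ici t₀, |(h t)⁻¹ - t / 2| ≤ B ∧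
      (∀ i, q i t ≤ D * h t ^ (4 / 3 : ℝ)) ∧ F t ≤ E * h t ^ 2 := by
  have hF : ∀ t ∈ Ici t₀, F t ≤ 1 / 10000 := fun t ht =>
    (S.F_lt hm hδ hδ1 hδm hF₀ hq t ht).le.trans hδ1
  have hs := S.s_le_of_q_le hm hδ hδm hδ1 hF hq
  obtain ⟨c, hc0, hc⟩ := S.s_le_mul_h hm (sq_nonneg δ) hF hs hq
  obtain ⟨C, hC0, hC⟩ := S.F_le_mul_h hF hs hc
  obtain ⟨u, hu, hhu, hu0, hu'⟩ := S.exists_sixth_root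
  obtain ⟨D, hD0, hD⟩ := S.q_le_pow hs hF hu hhu hu' (sq_nonneg δ) hc hC hq
  have hsD : ∀ t ∈ Ici t₀, s t ≤ D / (6 * m ^ 2) * u t ^ 8 := by
    intro t ht
    have hut := hu t ht
    refine (S.s_le t ht _ (fun i => hD i t ht) (by positivity)).trans (le_of_eq ?_)
    ring
  have hD1 : 0 ≤ D / (6 * m ^ 2) := by positivity
  obtain ⟨E, hE0, hE⟩ := S.F_le_pow hu hhu hu0 hu' hc0 hC0 hD1 hc hC hsD
  obtain ⟨B, hB⟩ := S.abs_inv_h_sub_le hu hu0 hu' hD1 hE0 hsD hE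
  refine ⟨B, D, E, hD0, hE0, fun t ht => ⟨hB t ht, fun i => ?_, ?_⟩⟩
  · have : h t ^ (4 / 3 : ℝ) = u t ^ 8 := by
      rw [hhu t ht, ← Real.rpow_natCast, ← Real.rpow_mul (hu t ht).le, ← Real.rpow_natCast]
      norm_num
    rw [this]
    exact hD i t ht
  · rw [hhu t ht, ← pow_mul]
    exact hE t ht

end ReducedSystem

/-! ### Linear algebra with respect to a metric. -/

theorem isSymm_of_posDef {g : Mat} (hg : g.PosDef) : gᵀ = g := by
  have := hg.isHermitian.eq
  rwa [conjTranspose_eq_transpose_of_trivial] at this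

theorem isSymm_inv_of_posDef {g : Mat} (hg : g.PosDef) : (g⁻¹)ᵀ = g⁻¹ :=
  isSymm_of_posDef hg.inv

theorem isUnit_det_of_posDef {g : Mat} (hg : g.PosDef) : IsUnit g.det :=
  hg.det_pos.ne'.isUnit

open scoped MatrixOrder in
-- `B` plays the role of an orthonormal frame: `A ↦ B A Bᵀ` and `p ↦ B p` turn `g`-norms into
-- Euclidean ones.
theorem exists_inv_eq_transpose_mul_self {g : Mat} (hg : g.PosDef) : ∃ B : Mat, g⁻¹ = Bᵀ * B := by
  obtain ⟨B, hB⟩ := CStarAlgebra.nonneg_iff_eq_star_mul_self.mp hg.inv.posSemidef.nonneg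
  exact ⟨B, by rw [hB, star_eq_conjTranspose, conjTranspose_eq_transpose_of_trivial]⟩

theorem covSq_eq_dotProduct (g : Mat) (p : Vec) : covSq g p = p ⬝ᵥ g⁻¹ *ᵥ p := by
  simp only [covSq, dotProduct, mulVec, Finset.mul_sum]
  exact Finset.sum_congr rfl fun a _ => Finset.sum_congr rfl fun b _ => by ring

theorem sum_mul_eq_trace (A B : Mat) : ∑ a, ∑ b, A a b * B a b = trace (Aᵀ * B) := by
  simp only [trace, diag, mul_apply, transpose_apply]
  exact Finset.sum_comm

theorem tr_eq_trace {g : Mat} (hg : g.PosDef) (A : Mat) : tr g A = trace (g⁻¹ * A) := by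
  rw [tr, sum_mul_eq_trace, isSymm_inv_of_posDef hg]

theorem tensorSq_eq_trace (g A : Mat) : tensorSq g A = trace ((g⁻¹)ᵀ * A * g⁻¹ * Aᵀ) := by
  simp only [tensorSq, trace, diag, mul_apply, transpose_apply, Fin.sum_univ_three]
  ring

theorem tensorSq_nonneg {g : Mat} (hg : g.PosDef) (A : Mat) : 0 ≤ tensorSq g A := by
  obtain ⟨B, hB⟩ := exists_inv_eq_transpose_mul_self hg
  have : tensorSq g A = trace ((B * A * Bᵀ)ᵀᵀ * (B * A * Bᵀ)ᵀ) := by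
    rw [tensorSq_eq_trace, isSymm_inv_of_posDef hg, hB]
    simp only [transpose_mul, transpose_transpose, Matrix.mul_assoc]
    rw [Matrix.trace_mul_comm Bᵀ]
    simp only [Matrix.mul_assoc]
  rw [this, ← sum_mul_eq_trace]
  exact Finset.sum_nonneg fun a _ => Finset.sum_nonneg fun b _ => mul_self_nonneg _

theorem sq_dotProduct_mulVec_le (M : Mat) (v : Vec) :
    (v ⬝ᵥ M *ᵥ v) ^ 2 ≤ (∑ a, ∑ b, M a b * M a b) * (v ⬝ᵥ v) ^ 2 := by
  have h := Finset.sum_mul_sq_le_sq_mul_sq (Finset.univ : Finset (Fin 3 × Fin 3))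
    (fun x => M x.1 x.2) (fun x => v x.1 * v x.2)
  simp only [Fintype.sum_prod_type] at h
  refine le_trans (le_of_eq ?_) (h.trans (le_of_eq ?_))
  · congr 1
    simp only [dotProduct, mulVec, Finset.mul_sum]
    exact Finset.sum_congr rfl fun a _ => Finset.sum_congr rfl fun b _ => by ring
  · congr 1
    · simp only [sq]
    · simp only [dotProduct, sq, Finset.sum_mul_sum]
      exact Finset.sum_congr rfl fun a _ => Finset.sum_congr rfl fun b _ => by ring

/-- The Cauchy-Schwarz inequality `|A^ab p_a p_b| ≤ (A_ab A^ab)^(1/2) g^ab p_a p_b`. -/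
theorem abs_raise_le {g : Mat} (hg : g.PosDef) (A : Mat) (p : Vec) :
    |p ⬝ᵥ (g⁻¹ * A * g⁻¹) *ᵥ p| ≤ √(tensorSq g A) * covSq g p := by
  obtain ⟨B, hB⟩ := exists_inv_eq_transpose_mul_self hg
  have h1 : tensorSq g A = ∑ a, ∑ b, (B * A * Bᵀ) a b * (B * A * Bᵀ) a b := by
    rw [sum_mul_eq_trace, Matrix.trace_mul_comm, tensorSq_eq_trace, isSymm_inv_of_posDef hg, hB]
    simp only [transpose_mul, transpose_transpose, Matrix.mul_assoc]
    rw [Matrix.trace_mul_comm Bᵀ]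
    simp only [Matrix.mul_assoc]
  have hdot : ∀ (N : Mat), p ⬝ᵥ (Bᵀ * N * B) *ᵥ p = (B *ᵥ p) ⬝ᵥ N *ᵥ (B *ᵥ p) := by
    intro N
    rw [← mulVec_mulVec, ← mulVec_mulVec, dotProduct_mulVec, vecMul_transpose]
  have h2 : covSq g p = (B *ᵥ p) ⬝ᵥ (B *ᵥ p) := by
    have := hdot 1
    rw [Matrix.mul_one, one_mulVec] at this
    rw [covSq_eq_dotProduct, hB, this]
  have h3 : p ⬝ᵥ (g⁻¹ * A * g⁻¹) *ᵥ p = (B *ᵥ p) ⬝ᵥ (B * A * Bᵀ) *ᵥ (B *ᵥ p) := by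
    rw [← hdot, hB]; simp only [Matrix.mul_assoc]
  have h4 : 0 ≤ covSq g p := by
    rw [h2]; exact Finset.sum_nonneg fun a _ => mul_self_nonneg _
  rw [h3, ← Real.sqrt_sq_eq_abs, ← Real.sqrt_sq h4, ← Real.sqrt_mul (tensorSq_nonneg hg A), h1, h2]
  exact Real.sqrt_le_sqrt (sq_dotProduct_mulVec_le _ _)

theorem covSq_nonneg {g : Mat} (hg : g.PosDef) (p : Vec) : 0 ≤ covSq g p := by
  rw [covSq_eq_dotProduct]
  simpa using hg.inv.posSemidef.dotProduct_mulVec_nonneg p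

/-! ### Calculus of matrix curves. -/

/-- The matrix-valued curve `A` has the derivative `A'` at `t` within `s`, entry by entry. -/
def HasEntryDeriv (A : ℝ → Mat) (A' : Mat) (s : Set ℝ) (t : ℝ) : Prop :=
  ∀ a b, HasDerivWithinAt (fun x => A x a b) (A' a b) s t

namespace HasEntryDeriv

variable {A B : ℝ → Mat} {A' B' : Mat} {s : Set ℝ} {t : ℝ}

theorem mul (hA : HasEntryDeriv A A' s t) (hB : HasEntryDeriv B B' s t) :
    HasEntryDeriv (fun x => A x * B x) (A' * B t + A t * B') s t := by
  intro a b
  simp only [mul_apply, Matrix.add_apply, ← Finset.sum_add_distrib]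
  exact HasDerivWithinAt.fun_sum fun c _ => (hA a c).fun_mul (hB c b)

theorem trace (hA : HasEntryDeriv A A' s t) :
    HasDerivWithinAt (fun x => (A x).trace) A'.trace s t := by
  simp only [Matrix.trace, diag]
  exact HasDerivWithinAt.fun_sum fun c _ => hA c c

theorem continuousWithinAt (hA : HasEntryDeriv A A' s t) : ContinuousWithinAt A s t :=
  continuousWithinAt_pi.2 fun a => continuousWithinAt_pi.2 fun b => (hA a b).continuousWithinAt

theorem mulVec (hA : HasEntryDeriv A A' s t) (p : Vec) :
    HasDerivWithinAt (fun x => A x *ᵥ p) (A' *ᵥ p) s t := by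
  rw [hasDerivWithinAt_pi]
  intro a
  simp only [Matrix.mulVec, dotProduct]
  exact HasDerivWithinAt.fun_sum fun c _ => (hA a c).mul_const _

/-- The identity `X⁻¹ - Y⁻¹ = -X⁻¹ (X - Y) Y⁻¹` expresses the slopes of the inverse through those of
`A`; Cramer's rule gives the continuity needed for the limit. -/
theorem inv (hA : HasEntryDeriv A A' s t) (ht : t ∈ s) (hdet : ∀ x ∈ s, IsUnit (A x).det) :
    HasEntryDeriv (fun x => (A x)⁻¹) (-((A t)⁻¹ * A' * (A t)⁻¹)) s t := by
  have hcont : ∀ a b, ContinuousWithinAt (fun x => (A x)⁻¹ a b) s t := by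
    intro a b
    have hA' := hA.continuousWithinAt
    have h1 : ContinuousWithinAt (fun x => (A x).det) s t :=
      (Continuous.matrix_det continuous_id).continuousAt.comp_continuousWithinAt hA'
    have h2 : ContinuousWithinAt (fun x => (A x).adjugate a b) s t :=
      ((Continuous.matrix_adjugate continuous_id).matrix_elem a b
        ).continuousAt.comp_continuousWithinAt hA'
    have h3 := (h1.inv₀ (hdet t ht).ne_zero).mul h2
    refine h3.congr_of_mem (fun x _ => ?_) ht
    simp [Matrix.inv_def]
  intro a b
  rw [hasDerivWithinAt_iff_tendsto_slope]
  have hslope : ∀ x ∈ s \ {t}, -∑ c, ∑ d, (A x)⁻¹ a c * slope (fun y => A y c d) t x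
      * (A t)⁻¹ d b = slope (fun y => (A y)⁻¹ a b) t x := by
    intro x hx
    have h1 : (A x)⁻¹ - (A t)⁻¹ = -((A x)⁻¹ * (A x - A t) * (A t)⁻¹) := by
      rw [Matrix.mul_sub, Matrix.sub_mul, nonsing_inv_mul _ (hdet x hx.1), Matrix.mul_assoc,
        mul_nonsing_inv _ (hdet t ht)]
      simp
    have h2 : (A x)⁻¹ a b - (A t)⁻¹ a b
        = -∑ c, ∑ d, (A x)⁻¹ a c * (A x c d - A t c d) * (A t)⁻¹ d b := by
      rw [← Matrix.sub_apply, h1, Matrix.neg_apply]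
      simp only [mul_apply, Matrix.sub_apply, Finset.sum_mul]
      rw [Finset.sum_comm]
    simp only [slope_def_field]
    rw [h2, neg_div, Finset.sum_div]
    congr 1
    refine Finset.sum_congr rfl fun c _ => ?_
    rw [Finset.sum_div]
    exact Finset.sum_congr rfl fun d _ => by ring
  have hlim : Tendsto (fun x => -∑ c, ∑ d, (A x)⁻¹ a c * slope (fun y => A y c d) t x
      * (A t)⁻¹ d b) (𝓝[s \ {t}] t) (𝓝 (-∑ c, ∑ d, (A t)⁻¹ a c * A' c d * (A t)⁻¹ d b)) := by
    refine (tendsto_finsetSum _ fun c _ => tendsto_finsetSum _ fun d _ => ?_).neg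
    refine Tendsto.mul_const _ (Tendsto.mul ?_ ?_)
    · exact (hcont a c).mono sdiff_subset
    · exact hasDerivWithinAt_iff_tendsto_slope.1 (hA c d)
  have hval : (-((A t)⁻¹ * A' * (A t)⁻¹)) a b
      = -∑ c, ∑ d, (A t)⁻¹ a c * A' c d * (A t)⁻¹ d b := by
    rw [Matrix.neg_apply]
    simp only [mul_apply, Finset.sum_mul]
    rw [Finset.sum_comm]
  rw [hval]
  exact hlim.congr' (by filter_upwards [self_mem_nhdsWithin] with x hx using hslope x hx)

end HasEntryDeriv

/-! Integrals over momentum space. -/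

section Matter

variable {m : ℝ} {g : Mat} {f : Vec → ℝ}

theorem energy_sq (hg : g.PosDef) (p : Vec) : energy m g p ^ 2 = m ^ 2 + covSq g p :=
  Real.sq_sqrt (add_nonneg (sq_nonneg m) (covSq_nonneg hg p))

theorem energy_pos (hm : 0 < m) (hg : g.PosDef) (p : Vec) : 0 < energy m g p :=
  Real.sqrt_pos.2 (add_pos_of_pos_of_nonneg (by positivity) (covSq_nonneg hg p))

theorem continuous_covSq (g : Mat) : Continuous (covSq g) := by
  unfold covSq; fun_prop

theorem continuous_energy (m : ℝ) (g : Mat) : Continuous (energy m g) :=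
  ((continuous_covSq g).const_add _).sqrt

theorem continuous_inCov (hf : Continuous f) : Continuous (inCov g f) :=
  hf.comp (Continuous.matrix_mulVec continuous_const continuous_id)

theorem abs_dotProduct_mulVec_le (hg : g.PosDef) (M : Mat) (p : Vec) :
    |p ⬝ᵥ M *ᵥ p| ≤ √(tensorSq g (g * M * g)) * covSq g p := by
  have h := abs_raise_le hg (g * M * g) p
  have hu := isUnit_det_of_posDef hg
  have : g⁻¹ * (g * M * g) * g⁻¹ = M := by
    rw [← Matrix.mul_assoc, ← Matrix.mul_assoc, nonsing_inv_mul _ hu, Matrix.one_mul,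
      Matrix.mul_assoc, mul_nonsing_inv _ hu, Matrix.mul_one]
  rwa [this] at h

/-- A quadratic form in `p` is at most a constant times `(p^0)²`, so finite energy density dominates
every stress integrand. -/
theorem integrable_quadratic (hm : 0 < m) (hg : g.PosDef) (hf : Continuous f) (hf0 : ∀ p, 0 ≤ f p)
    (hint : Integrable fun p : Vec => inCov g f p * energy m g p * (√g.det)⁻¹) (M : Mat) :
    Integrable fun p : Vec =>
      inCov g f p * (p ⬝ᵥ M *ᵥ p) * (energy m g p)⁻¹ * (√g.det)⁻¹ := by
  refine (hint.const_mul (√(tensorSq g (g * M * g)))).mono' ?_ ?_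
  · refine Continuous.aestronglyMeasurable ?_
    have h1 := continuous_inCov (g := g) hf
    have h2 := continuous_energy m g
    have h3 : Continuous fun p => (energy m g p)⁻¹ := h2.inv₀ fun p => (energy_pos hm hg p).ne'
    have h4 : Continuous fun p : Vec => p ⬝ᵥ M *ᵥ p :=
      Continuous.dotProduct continuous_id (Continuous.matrix_mulVec continuous_const continuous_id)
    exact ((h1.mul h4).mul h3).mul_const _
  · refine ae_of_all _ fun p => ?_
    have hE := energy_pos hm hg p
    have hf1 : 0 ≤ inCov g f p := hf0 _
    have h1 : |p ⬝ᵥ M *ᵥ p| * (energy m g p)⁻¹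
        ≤ √(tensorSq g (g * M * g)) * energy m g p := by
      rw [← div_eq_mul_inv, div_le_iff₀ hE, mul_assoc, ← sq, energy_sq hg]
      refine (abs_dotProduct_mulVec_le hg M p).trans ?_
      gcongr
      linarith [sq_nonneg m]
    rw [Real.norm_eq_abs, abs_mul, abs_mul, abs_mul, abs_of_nonneg hf1, abs_of_pos (inv_pos.2 hE),
      abs_of_nonneg (inv_nonneg.2 (Real.sqrt_nonneg _))]
    calc inCov g f p * |p ⬝ᵥ M *ᵥ p| * (energy m g p)⁻¹ * (√g.det)⁻¹
        = inCov g f p * (|p ⬝ᵥ M *ᵥ p| * (energy m g p)⁻¹) * (√g.det)⁻¹ := by ring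
      _ ≤ inCov g f p * (√(tensorSq g (g * M * g)) * energy m g p) * (√g.det)⁻¹ := by gcongr
      _ = _ := by ring

theorem sum_mul_stress (hm : 0 < m) (hg : g.PosDef) (hf : Continuous f) (hf0 : ∀ p, 0 ≤ f p)
    (hint : Integrable fun p : Vec => inCov g f p * energy m g p * (√g.det)⁻¹) (M : Mat) :
    ∑ a, ∑ b, M a b * stress m g f a b = ∫ p : Vec,
      inCov g f p * (p ⬝ᵥ M *ᵥ p) * (energy m g p)⁻¹ * (√g.det)⁻¹ := by
  have hentry : ∀ a b, Integrable fun p : Vec =>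
      M a b * (inCov g f p * p a * p b * (energy m g p)⁻¹ * (√g.det)⁻¹) := by
    intro a b
    refine Integrable.const_mul ?_ _
    refine (integrable_quadratic hm hg hf hf0 hint (Matrix.single a b 1)).congr
      (ae_of_all _ fun p => ?_)
    have : p ⬝ᵥ (Matrix.single a b (1 : ℝ)) *ᵥ p = p a * p b := by
      rw [single_mulVec]
      simp [dotProduct, Function.update_apply]
    simp only [this]
    ring
  simp only [stress, of_apply, ← integral_const_mul]
  have hsum : ∀ a, ∑ b, ∫ p : Vec,
      M a b * (inCov g f p * p a * p b * (energy m g p)⁻¹ * (√g.det)⁻¹)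
      = ∫ p : Vec, ∑ b,
      M a b * (inCov g f p * p a * p b * (energy m g p)⁻¹ * (√g.det)⁻¹) := fun a =>
    (integral_finsetSum _ fun b _ => hentry a b).symm
  rw [Finset.sum_congr rfl fun a _ => hsum a,
    ← integral_finsetSum _ fun a _ => integrable_finsetSum _ fun b _ => hentry a b]
  congr 1
  ext p
  simp only [dotProduct, mulVec, Finset.mul_sum, Finset.sum_mul]
  exact Finset.sum_congr rfl fun a _ => Finset.sum_congr rfl fun b _ => by ring

theorem stress_symm (m : ℝ) (g : Mat) (f : Vec → ℝ) : (stress m g f)ᵀ = stress m g f := by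
  ext a b
  simp only [transpose_apply, stress, of_apply]
  congr 1
  ext p
  ring

theorem rho_nonneg (hf0 : ∀ p, 0 ≤ f p) : 0 ≤ rho m g f :=
  integral_nonneg fun _ => mul_nonneg (mul_nonneg (hf0 _) (Real.sqrt_nonneg _))
    (inv_nonneg.2 (Real.sqrt_nonneg _))

theorem tr_stress_eq (hm : 0 < m) (hg : g.PosDef) (hf : Continuous f) (hf0 : ∀ p, 0 ≤ f p)
    (hint : Integrable fun p : Vec => inCov g f p * energy m g p * (√g.det)⁻¹) :
    tr g (stress m g f) = ∫ p : Vec,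
      inCov g f p * covSq g p * (energy m g p)⁻¹ * (√g.det)⁻¹ := by
  rw [tr, sum_mul_stress hm hg hf hf0 hint]
  simp only [covSq_eq_dotProduct]

theorem tr_stress_nonneg (hm : 0 < m) (hg : g.PosDef) (hf : Continuous f) (hf0 : ∀ p, 0 ≤ f p)
    (hint : Integrable fun p : Vec => inCov g f p * energy m g p * (√g.det)⁻¹) :
    0 ≤ tr g (stress m g f) := by
  rw [tr_stress_eq hm hg hf hf0 hint]
  exact integral_nonneg fun p => mul_nonneg (mul_nonneg (mul_nonneg (hf0 _) (covSq_nonneg hg p))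
    (inv_nonneg.2 (Real.sqrt_nonneg _))) (inv_nonneg.2 (Real.sqrt_nonneg _))

theorem integrable_covSq (hm : 0 < m) (hg : g.PosDef) (hf : Continuous f) (hf0 : ∀ p, 0 ≤ f p)
    (hint : Integrable fun p : Vec => inCov g f p * energy m g p * (√g.det)⁻¹) :
    Integrable fun p : Vec =>
      inCov g f p * covSq g p * (energy m g p)⁻¹ * (√g.det)⁻¹ := by
  simp only [covSq_eq_dotProduct]
  exact integrable_quadratic hm hg hf hf0 hint g⁻¹

theorem tr_stress_le_mul_rho (hm : 0 < m) (hg : g.PosDef) (hf : Continuous f)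
    (hf0 : ∀ p, 0 ≤ f p)
    (hint : Integrable fun p : Vec => inCov g f p * energy m g p * (√g.det)⁻¹) {c : ℝ}
    (hc : ∀ p, inCov g f p ≠ 0 → covSq g p ≤ c * energy m g p ^ 2) :
    tr g (stress m g f) ≤ c * rho m g f := by
  rw [tr_stress_eq hm hg hf hf0 hint, rho, ← integral_const_mul]
  refine integral_mono (integrable_covSq hm hg hf hf0 hint) (hint.const_mul c) fun p => ?_
  by_cases hp : inCov g f p = 0
  · simp [hp]
  have hE := energy_pos hm hg p
  have hf1 : 0 ≤ inCov g f p := hf0 _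
  have h1 : covSq g p * (energy m g p)⁻¹ ≤ c * energy m g p := by
    rw [← div_eq_mul_inv, div_le_iff₀ hE, mul_assoc, ← sq]
    exact hc p hp
  calc inCov g f p * covSq g p * (energy m g p)⁻¹ * (√g.det)⁻¹
      = inCov g f p * (covSq g p * (energy m g p)⁻¹) * (√g.det)⁻¹ := by ring
    _ ≤ inCov g f p * (c * energy m g p) * (√g.det)⁻¹ := by gcongr
    _ = _ := by ring

theorem tr_stress_le_rho (hm : 0 < m) (hg : g.PosDef) (hf : Continuous f)
    (hf0 : ∀ p, 0 ≤ f p)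
    (hint : Integrable fun p : Vec => inCov g f p * energy m g p * (√g.det)⁻¹) :
    tr g (stress m g f) ≤ rho m g f := by
  have := tr_stress_le_mul_rho hm hg hf hf0 hint (c := 1) fun p _ => by
    rw [one_mul, energy_sq hg]; linarith [sq_nonneg m]
  rwa [one_mul] at this

/-- `|A^ab S_ab| ≤ (A_ab A^ab)^(1/2) tr S`. -/
theorem abs_raise_stress_le (hm : 0 < m) (hg : g.PosDef) (hf : Continuous f)
    (hf0 : ∀ p, 0 ≤ f p)
    (hint : Integrable fun p : Vec => inCov g f p * energy m g p * (√g.det)⁻¹) (A : Mat) :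
    |trace (g⁻¹ * A * g⁻¹ * stress m g f)| ≤ √(tensorSq g A) * tr g (stress m g f) := by
  have h1 : trace (g⁻¹ * A * g⁻¹ * stress m g f)
      = ∑ a, ∑ b, (g⁻¹ * A * g⁻¹) a b * stress m g f a b := by
    rw [sum_mul_eq_trace, ← trace_transpose, transpose_mul, stress_symm, trace_mul_comm]
  rw [h1, sum_mul_stress hm hg hf hf0 hint, tr_stress_eq hm hg hf hf0 hint, ← integral_const_mul]
  refine abs_integral_le_integral_abs.trans (integral_mono
    (integrable_quadratic hm hg hf hf0 hint _).abs
    ((integrable_covSq hm hg hf hf0 hint).const_mul _) fun p => ?_)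
  have hE := energy_pos hm hg p
  have hf1 : 0 ≤ inCov g f p := hf0 _
  simp only
  rw [abs_mul, abs_mul, abs_mul, abs_of_nonneg hf1, abs_of_pos (inv_pos.2 hE),
      abs_of_nonneg (inv_nonneg.2 (Real.sqrt_nonneg _))]
  calc inCov g f p * |p ⬝ᵥ (g⁻¹ * A * g⁻¹) *ᵥ p| * (energy m g p)⁻¹ * (√g.det)⁻¹
      ≤ inCov g f p * (√(tensorSq g A) * covSq g p) * (energy m g p)⁻¹ * (√g.det)⁻¹ := by
        gcongr; exact abs_raise_le hg A p
    _ = _ := by ring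

end Matter

/-! ### Evolution of the geometric quantities and conservation of the density. -/

/-- The term `σ^ab S_ab`. -/
def shearStress (m : ℝ) (g k : Mat) (f : Vec → ℝ) : ℝ :=
  trace (g⁻¹ * shear g k * g⁻¹ * stress m g f)

namespace IsSolution

variable {m t₀ : ℝ} {g k : ℝ → Mat} {f : ℝ → Vec → ℝ}

theorem hasEntryDeriv_metric (S : IsSolution m t₀ g k f) {t : ℝ} (ht : t ∈ Ici t₀) :
    HasEntryDeriv g ((-2 : ℝ) • k t) (Ici t₀) t := fun a b => by
  simpa using S.evol_g t ht a b

/-- Symmetry of `k` is inherited from `g` through `k = -ġ/2` and uniqueness of derivatives. -/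
theorem transpose_secondForm (S : IsSolution m t₀ g k f) {t : ℝ} (ht : t ∈ Ici t₀) :
    (k t)ᵀ = k t := by
  ext a b
  have h1 := S.evol_g t ht a b
  have h2 : HasDerivWithinAt (fun s => g s a b) (-2 * k t b a) (Ici t₀) t := by
    refine (S.evol_g t ht b a).congr_of_mem (fun s hs => ?_) ht
    have := congrFun (congrFun (isSymm_of_posDef (S.posDef s hs)) a) b
    simpa using this.symm
  have h3 := (uniqueDiffOn_Ici t₀ t ht).eq_deriv _ h1 h2
  rw [transpose_apply]
  linarith

theorem hasEntryDeriv_inv_metric (S : IsSolution m t₀ g k f) {t : ℝ} (ht : t ∈ Ici t₀) :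
    HasEntryDeriv (fun t => (g t)⁻¹) ((2 : ℝ) • ((g t)⁻¹ * k t * (g t)⁻¹)) (Ici t₀) t := by
  have := (S.hasEntryDeriv_metric ht).inv ht fun x hx => isUnit_det_of_posDef (S.posDef x hx)
  simpa using this

/-- The evolution of the second fundamental form in mixed components `k^a_b`. -/
theorem hasEntryDeriv_mixed (S : IsSolution m t₀ g k f) {t : ℝ} (ht : t ∈ Ici t₀) :
    HasEntryDeriv (fun t => (g t)⁻¹ * k t)
      (H (g t) (k t) • ((g t)⁻¹ * k t) - (8 * Real.pi) • ((g t)⁻¹ * stress m (g t) (f t))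
        + (4 * Real.pi * (tr (g t) (stress m (g t) (f t)) - rho m (g t) (f t))) • (1 : Mat))
      (Ici t₀) t := by
  have hk : HasEntryDeriv k (H (g t) (k t) • k t - (2 : ℝ) • (k t * (g t)⁻¹ * k t)
      - (8 * Real.pi) • stress m (g t) (f t)
      + (4 * Real.pi * (tr (g t) (stress m (g t) (f t)) - rho m (g t) (f t))) • g t)
      (Ici t₀) t := by
    intro a b
    refine (S.evol_k t ht a b).congr_deriv ?_
    simp only [Matrix.add_apply, Matrix.sub_apply, Matrix.smul_apply, smul_eq_mul]
    ring
  -- Raising an index contributes `2 k^a_c k^c_b`, which cancels the quadratic term of the evolution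
  -- equation.
  have h := (S.hasEntryDeriv_inv_metric ht).mul hk
  convert h using 1
  have hu := isUnit_det_of_posDef (S.posDef t ht)
  simp only [Matrix.mul_add, Matrix.mul_sub, Matrix.mul_smul, Matrix.smul_mul,
    nonsing_inv_mul _ hu, Matrix.mul_assoc]
  abel

theorem tensorSq_secondForm (S : IsSolution m t₀ g k f) {t : ℝ} (ht : t ∈ Ici t₀) :
    tensorSq (g t) (k t) = trace ((g t)⁻¹ * k t * ((g t)⁻¹ * k t)) := by
  rw [tensorSq_eq_trace, isSymm_inv_of_posDef (S.posDef t ht), S.transpose_secondForm ht]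
  simp only [Matrix.mul_assoc]

theorem inv_mul_shear (S : IsSolution m t₀ g k f) {t : ℝ} (ht : t ∈ Ici t₀) :
    (g t)⁻¹ * shear (g t) (k t)
      = (g t)⁻¹ * k t - (H (g t) (k t) / 3) • (1 : Mat) := by
  rw [shear, Matrix.mul_sub, Matrix.mul_smul,
    nonsing_inv_mul _ (isUnit_det_of_posDef (S.posDef t ht))]

theorem tensorSq_shear (S : IsSolution m t₀ g k f) {t : ℝ} (ht : t ∈ Ici t₀) :
    tensorSq (g t) (shear (g t) (k t))
      = trace ((g t)⁻¹ * k t * ((g t)⁻¹ * k t)) - H (g t) (k t) ^ 2 / 3 := by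
  have hs : (shear (g t) (k t))ᵀ = shear (g t) (k t) := by
    rw [shear, transpose_sub, transpose_smul, S.transpose_secondForm ht,
      isSymm_of_posDef (S.posDef t ht)]
  have hH : H (g t) (k t) = trace ((g t)⁻¹ * k t) := tr_eq_trace (S.posDef t ht) _
  rw [tensorSq_eq_trace, isSymm_inv_of_posDef (S.posDef t ht), hs, Matrix.mul_assoc,
    S.inv_mul_shear ht]
  simp only [Matrix.sub_mul, Matrix.mul_sub, Matrix.smul_mul, Matrix.mul_smul, Matrix.one_mul,
    Matrix.mul_one, trace_sub, trace_smul, trace_one, smul_eq_mul, ← hH, Fintype.card_fin]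
  push_cast
  ring

theorem rho_eq (S : IsSolution m t₀ g k f) {t : ℝ} (ht : t ∈ Ici t₀) :
    16 * Real.pi * rho m (g t) (f t)
      = 2 / 3 * H (g t) (k t) ^ 2 - tensorSq (g t) (shear (g t) (k t)) := by
  rw [← S.hamiltonian t ht, S.tensorSq_secondForm ht, S.tensorSq_shear ht]
  ring

/-- The trace of the mixed equation is `H² + 4π tr S - 12πρ`; the constraint trades `ρ` for `H²` and
the shear, so that every term is nonnegative. -/
theorem hasDerivWithinAt_H (S : IsSolution m t₀ g k f) {t : ℝ} (ht : t ∈ Ici t₀) :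
    HasDerivWithinAt (fun t => H (g t) (k t))
      (H (g t) (k t) ^ 2 / 2 + 3 / 4 * tensorSq (g t) (shear (g t) (k t))
        + 4 * Real.pi * tr (g t) (stress m (g t) (f t))) (Ici t₀) t := by
  have h := (S.hasEntryDeriv_mixed ht).trace
  have hH : ∀ s ∈ Ici t₀, H (g s) (k s) = trace ((g s)⁻¹ * k s) := fun s hs =>
    tr_eq_trace (S.posDef s hs) _
  refine (h.congr_of_mem hH ht).congr_deriv ?_
  have hρ := S.rho_eq ht
  simp only [trace_add, trace_sub, trace_smul, trace_one, smul_eq_mul, ← hH t ht,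
    ← tr_eq_trace (S.posDef t ht), Fintype.card_fin]
  push_cast
  linarith

theorem hasDerivWithinAt_shearSq (S : IsSolution m t₀ g k f) {t : ℝ} (ht : t ∈ Ici t₀) :
    HasDerivWithinAt (fun t => tensorSq (g t) (shear (g t) (k t)))
      (2 * H (g t) (k t) * tensorSq (g t) (shear (g t) (k t))
        - 16 * Real.pi * shearStress m (g t) (k t) (f t)) (Ici t₀) t := by
  have hK := S.hasEntryDeriv_mixed ht
  have h := ((hK.mul hK).trace).fun_sub (((S.hasDerivWithinAt_H ht).fun_pow 2).div_const 3)
  refine (h.congr_of_mem (fun s hs => S.tensorSq_shear hs) ht).congr_deriv ?_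
  have hH : H (g t) (k t) = trace ((g t)⁻¹ * k t) := tr_eq_trace (S.posDef t ht) _
  have hρ := S.rho_eq ht
  have hX : shearStress m (g t) (k t) (f t)
      = trace ((g t)⁻¹ * k t * ((g t)⁻¹ * stress m (g t) (f t)))
        - H (g t) (k t) / 3 * tr (g t) (stress m (g t) (f t)) := by
    rw [shearStress, S.inv_mul_shear ht, tr_eq_trace (S.posDef t ht) (stress _ _ _)]
    simp only [Matrix.sub_mul, Matrix.smul_mul, Matrix.one_mul, trace_sub, trace_smul, smul_eq_mul,
      Matrix.mul_assoc]
  have hσ := S.tensorSq_shear ht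
  have hcomm := trace_mul_comm ((g t)⁻¹ * stress m (g t) (f t)) ((g t)⁻¹ * k t)
  simp only [Matrix.add_mul, Matrix.mul_add, Matrix.sub_mul, Matrix.mul_sub, Matrix.smul_mul,
    Matrix.mul_smul, Matrix.one_mul, Matrix.mul_one, trace_add, trace_sub, trace_smul,
    smul_eq_mul, ← hH]
  rw [hcomm, hX]
  set N := trace ((g t)⁻¹ * k t * ((g t)⁻¹ * k t))
  set Z := trace ((g t)⁻¹ * k t * ((g t)⁻¹ * stress m (g t) (f t)))
  have hρ' : Real.pi * rho m (g t) (f t)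
      = (2 / 3 * H (g t) (k t) ^ 2 - tensorSq (g t) (shear (g t) (k t))) / 16 := by linarith
  push_cast
  rw [hσ]
  rw [hσ] at hρ'
  linear_combination (-8 * H (g t) (k t)) * hρ'

theorem hasDerivWithinAt_covSq (S : IsSolution m t₀ g k f) (p : Vec) {t : ℝ} (ht : t ∈ Ici t₀) :
    HasDerivWithinAt (fun t => covSq (g t) p)
      (2 * (p ⬝ᵥ ((g t)⁻¹ * shear (g t) (k t) * (g t)⁻¹) *ᵥ p)
        + 2 / 3 * H (g t) (k t) * covSq (g t) p) (Ici t₀) t := by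
  have h := (S.hasEntryDeriv_inv_metric ht).mulVec p
  rw [hasDerivWithinAt_pi] at h
  have h2 : HasDerivWithinAt (fun t => p ⬝ᵥ (g t)⁻¹ *ᵥ p)
      (p ⬝ᵥ ((2 : ℝ) • ((g t)⁻¹ * k t * (g t)⁻¹)) *ᵥ p) (Ici t₀) t := by
    simp only [dotProduct]
    exact HasDerivWithinAt.fun_sum fun c _ => (h c).const_mul _
  simp only [covSq_eq_dotProduct]
  refine h2.congr_deriv ?_
  rw [S.inv_mul_shear ht]
  simp only [Matrix.sub_mul, Matrix.smul_mul, Matrix.one_mul, sub_mulVec, smul_mulVec,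
    dotProduct_sub, dotProduct_smul, smul_eq_mul]
  ring

theorem continuous_density (S : IsSolution m t₀ g k f) {t : ℝ} (ht : t ∈ Ici t₀) :
    Continuous (f t) := by
  have h := S.smooth_f.continuousOn
  exact h.comp_continuous (f := fun p : Vec => (t, p)) (by fun_prop) fun p => ⟨ht, mem_univ _⟩

/-- The density is conserved along the characteristics, on which the covariant momenta are
constant. -/
theorem inCov_eq (S : IsSolution m t₀ g k f) {t : ℝ} (ht : t ∈ Ici t₀) :
    inCov (g t) (f t) = inCov (g t₀) (f t₀) := by
  funext p
  set φ : ℝ → ℝ := fun s => inCov (g s) (f s) p with hφ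
  have hd : ∀ s ∈ Ici t₀, HasDerivWithinAt φ 0 (Ici t₀) s := by
    intro s hs
    set v : Vec := (g s)⁻¹ *ᵥ p with hv
    set L := fderivWithin ℝ (fun x : ℝ × Vec => f x.1 x.2) (Ici t₀ ×ˢ univ) (s, v) with hL
    have hmem : (s, v) ∈ Ici t₀ ×ˢ (univ : Set Vec) := ⟨hs, mem_univ _⟩
    have hfd : HasFDerivWithinAt (fun x : ℝ × Vec => f x.1 x.2) L (Ici t₀ ×ˢ univ) (s, v) :=
      ((S.smooth_f.differentiableOn (by simp)) _ hmem).hasFDerivWithinAt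
    have hY := (S.hasEntryDeriv_inv_metric hs).mulVec p
    have htime : HasDerivWithinAt (fun r => f r v) (L (1, 0)) (Ici t₀) s :=
      hfd.comp_hasDerivWithinAt_of_eq (f := fun r => (r, v)) s
        ((hasDerivWithinAt_id s _).prodMk (hasDerivWithinAt_const s _ v))
        (fun r hr => ⟨hr, mem_univ _⟩) rfl
    have hspace : ∀ w : Vec, fderiv ℝ (f s) v w = L (0, w) := by
      intro w
      have h1 : HasFDerivAt (f s) (L.comp (ContinuousLinearMap.inr ℝ ℝ Vec)) v := by
        rw [← hasFDerivWithinAt_univ]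
        exact hfd.comp (f := fun w : Vec => (s, w)) v
          (hasFDerivAt_prodMk_right s v).hasFDerivWithinAt fun w _ => ⟨hs, mem_univ _⟩
      rw [h1.fderiv]
      simp
    have hcurve : HasDerivWithinAt φ
        (L (1, ((2 : ℝ) • ((g s)⁻¹ * k s * (g s)⁻¹)) *ᵥ p)) (Ici t₀) s :=
      hfd.comp_hasDerivWithinAt_of_eq (f := fun r => (r, (g r)⁻¹ *ᵥ p)) s
        ((hasDerivWithinAt_id s _).prodMk hY) (fun r hr => ⟨hr, mem_univ _⟩) rfl
    refine hcurve.congr_deriv ?_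
    have hvl := S.vlasov s hs v
    rw [htime.derivWithin (uniqueDiffOn_Ici t₀ s hs)] at hvl
    set w : Vec := ((2 : ℝ) • ((g s)⁻¹ * k s * (g s)⁻¹)) *ᵥ p with hw
    -- At fixed `p_a` the contravariant momentum moves with velocity `2 k^a_b p^b`, so the Vlasov
    -- operator is the derivative along this curve.
    have hw' : w = ∑ a, (2 * (((g s)⁻¹ * k s) *ᵥ v) a) • (Pi.single a 1 : Vec) := by
      rw [hw, smul_mulVec, ← mulVec_mulVec, ← hv]
      ext b
      simp [Finset.sum_apply, Pi.single_apply]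
    have hsplit : ((1 : ℝ), w) = (1, 0) + (0, w) := by simp
    rw [hsplit, map_add, ← hspace, hw', map_sum]
    simpa only [map_smul, smul_eq_mul] using hvl
  have := constant_of_has_deriv_right_zero (f := φ) (a := t₀) (b := t)
    (fun s hs => ((hd s hs.1).continuousWithinAt).mono Icc_subset_Ici_self)
    (fun s hs => (hd s hs.1).mono (Ici_subset_Ici.2 hs.1)) t ⟨ht, le_rfl⟩
  exact this

end IsSolution

/-! ### Sign of `H` and the reduction to the scalar system. -/

namespace IsSolution

variable {m t₀ : ℝ} {g k : ℝ → Mat} {f : ℝ → Vec → ℝ}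

theorem tr_stress_nonneg (S : IsSolution m t₀ g k f) (hm : 0 < m) {t : ℝ} (ht : t ∈ Ici t₀) :
    0 ≤ tr (g t) (stress m (g t) (f t)) :=
  BianchiI.tr_stress_nonneg hm (S.posDef t ht) (S.continuous_density ht) (S.f_nonneg t ht)
    (S.integrable t ht)

/-- A solution on `[t₀, ∞)` with `H(t₀) ≠ 0` is expanding at all times. -/
theorem H_neg (S : IsSolution m t₀ g k f) (hm : 0 < m) (h0 : H (g t₀) (k t₀) ≠ 0) :
    ∀ t ∈ Ici t₀, H (g t) (k t) < 0 := by
  set h : ℝ → ℝ := fun t => H (g t) (k t) with hh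
  set h' : ℝ → ℝ := fun t => H (g t) (k t) ^ 2 / 2
    + 3 / 4 * tensorSq (g t) (shear (g t) (k t))
    + 4 * Real.pi * tr (g t) (stress m (g t) (f t)) with hh'
  have hd : ∀ t ∈ Ici t₀, HasDerivWithinAt h (h' t) (Ici t₀) t := fun t ht =>
    S.hasDerivWithinAt_H ht
  have hlow : ∀ t ∈ Ici t₀, h t ^ 2 / 2 ≤ h' t := by
    intro t ht
    have h1 := tensorSq_nonneg (S.posDef t ht) (shear (g t) (k t))
    have h2 := mul_nonneg Real.pi_pos.le (S.tr_stress_nonneg hm ht)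
    simp only [hh, hh']
    linarith
  have hupp : ∀ t ∈ Ici t₀, h' t ≤ 2 * h t ^ 2 := by
    intro t ht
    have h1 := tensorSq_nonneg (S.posDef t ht) (shear (g t) (k t))
    have h2 := mul_le_mul_of_nonneg_left (tr_stress_le_rho hm (S.posDef t ht)
      (S.continuous_density ht) (S.f_nonneg t ht) (S.integrable t ht)) Real.pi_pos.le
    have h3 := S.rho_eq ht
    have h4 := mul_nonneg Real.pi_pos.le (rho_nonneg (m := m) (g := g t) (S.f_nonneg t ht))
    simp only [hh, hh']
    linarith
  have hanti : AntitoneOn (fun t => -h t) (Ici t₀) :=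
    antitoneOn_Ici_of_hasDerivWithinAt (fun t ht => (hd t ht).fun_neg) fun t ht => by
      linarith [hlow t ht, sq_nonneg (h t)]
  have hneg0 : h t₀ < 0 := by
    by_contra! hcon
    have hpos : ∀ t ∈ Ici t₀, 0 < h t := by
      intro t ht
      have h1 := hanti self_mem_Ici ht ht
      have h2 : 0 < h t₀ := lt_of_le_of_ne hcon (Ne.symm h0)
      simp only at h1
      linarith
    -- Here `h` is `H` itself. The Riccati inequality `h' ≥ h²/2` would force `1/h ≤ 0` by time `t₀
    -- + 2 / h t₀`.
    have hinv : AntitoneOn (fun t => (h t)⁻¹ + t / 2) (Ici t₀) := by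
      refine antitoneOn_Ici_of_hasDerivWithinAt (fun t ht => ((hd t ht).fun_inv
        (hpos t ht).ne').fun_add ((hasDerivWithinAt_id t _).div_const 2)) fun t ht => ?_
      have h1 := hpos t ht
      have h2 : 1 / 2 ≤ h' t / h t ^ 2 := by
        rw [le_div_iff₀ (by positivity)]; linarith [hlow t ht]
      rw [neg_div]
      linarith
    have hT : t₀ + 2 * (h t₀)⁻¹ ∈ Ici t₀ := by
      have := inv_pos.2 (hpos t₀ self_mem_Ici)
      simp only [mem_Ici]; linarith
    have h1 := hinv self_mem_Ici hT hT
    have h2 := inv_pos.2 (hpos _ hT)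
    simp only at h1
    linarith
  refine lt_of_forall_first_time_ne (fun t ht => (hd t ht).continuousWithinAt) hneg0 ?_
  intro b hb hlt hbeq
  change h b = 0 at hbeq
  set M : ℝ := -h t₀ with hM
  -- Since `-M ≤ h ≤ 0` up to time `b`, the bound `h' ≤ 2h²` gives the linear inequality `h' ≤
  -- -2Mh`, so zero is not reached in finite time.
  have hexp : AntitoneOn (fun t => h t * Real.exp (2 * M * t)) (Icc t₀ b) := by
    refine antitoneOn_Icc_of_hasDerivWithinAt (fun t ht => (hd t ht).fun_mul
      (((hasDerivWithinAt_id t _).const_mul (2 * M)).exp)) fun t ht => ?_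
    have h1 : -h t ≤ M := hanti self_mem_Ici ht.1 ht.1
    have h2 : h t ≤ 0 := by
      rcases ht.2.eq_or_lt with h3 | h3
      · rw [h3, hbeq]
      · exact (hlt t ⟨ht.1, h3⟩).le
    have h3 : h' t + 2 * M * h t ≤ 0 := by nlinarith [hupp t ht.1]
    have := mul_nonpos_of_nonpos_of_nonneg h3 (Real.exp_pos (2 * M * t)).le
    simp only [id]
    linarith
  have h1 := hexp ⟨le_rfl, hb.le⟩ ⟨hb.le, le_rfl⟩ hb.le
  simp only [hbeq, zero_mul] at h1
  exact absurd (mul_neg_of_neg_of_pos hneg0 (Real.exp_pos (2 * M * t₀))) (not_lt.2 h1)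

/-- The particles are labelled by the initial support in covariant momenta. The bound on `s`
combines `tr S ≤ (Q/m²) ρ`, from `p^0 ≥ m`, with `4πρ ≤ H²/6`, from the constraint. -/
theorem reducedSystem (S : IsSolution m t₀ g k f) (hm : 0 < m) (h0 : H (g t₀) (k t₀) ≠ 0) :
    ReducedSystem m t₀ (fun t => -H (g t) (k t)) (fun t => F (g t) (k t))
      (fun t => 4 * Real.pi * tr (g t) (stress m (g t) (f t)) / H (g t) (k t) ^ 2)
      (fun (p : {p : Vec // inCov (g t₀) (f t₀) p ≠ 0}) t => covSq (g t) p) := by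
  have hH := S.H_neg hm h0
  have hsqrt : ∀ t ∈ Ici t₀, √(tensorSq (g t) (shear (g t) (k t)))
      = √(F (g t) (k t)) * -H (g t) (k t) := by
    intro t ht
    have h1 : tensorSq (g t) (shear (g t) (k t)) = F (g t) (k t) * (-H (g t) (k t)) ^ 2 := by
      have := (hH t ht).ne
      rw [F]; field_simp
    rw [h1, Real.sqrt_mul' _ (sq_nonneg _), Real.sqrt_sq (by linarith [hH t ht])]
  refine ⟨fun t ht => by linarith [hH t ht], fun t ht => ?_, fun t ht => ?_,
    fun p t ht => covSq_nonneg (S.posDef t ht) _, fun t ht => ?_, ?_, fun p => ?_,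
    fun t ht Q hQ hQ0 => ?_⟩
  · exact div_nonneg (tensorSq_nonneg (S.posDef t ht) _) (sq_nonneg _)
  · have := S.tr_stress_nonneg hm ht
    positivity
  · refine (S.hasDerivWithinAt_H ht).fun_neg.congr_deriv ?_
    have := (hH t ht).ne
    rw [F]; field_simp
  · refine ⟨_, fun t ht => ⟨(S.hasDerivWithinAt_shearSq ht).fun_div
      ((S.hasDerivWithinAt_H ht).fun_pow 2) (pow_ne_zero 2 (hH t ht).ne), ?_⟩⟩
    have hX := abs_raise_stress_le hm (S.posDef t ht) (S.continuous_density ht)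
      (S.f_nonneg t ht) (S.integrable t ht) (shear (g t) (k t))
    rw [hsqrt t ht] at hX
    have hX' := (abs_le.1 hX).1
    change _ ≤ shearStress m (g t) (k t) (f t) at hX'
    have hsq : tensorSq (g t) (shear (g t) (k t)) = F (g t) (k t) * H (g t) (k t) ^ 2 := by
      have := (hH t ht).ne
      rw [F]; field_simp
    rw [hsq]
    have hHt := hH t ht
    set Φ := F (g t) (k t)
    set η := H (g t) (k t)
    set T := tr (g t) (stress m (g t) (f t))
    set X := shearStress m (g t) (k t) (f t)
    have hη : η ≠ 0 := hHt.ne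
    -- The stress term of `F'`, bounded through `|σ^ab S_ab| ≤ √F h tr S`.
    have key : -(16 * Real.pi * X) / η ^ 2 ≤ 4 * (4 * Real.pi * T / η ^ 2) * √Φ * -η := by
      rw [show 4 * (4 * Real.pi * T / η ^ 2) * √Φ * -η
        = 16 * Real.pi * (√Φ * -η * T) / η ^ 2 by ring]
      refine div_le_div_of_nonneg_right ?_ (sq_nonneg η)
      nlinarith [Real.pi_pos]
    refine le_trans (le_of_eq ?_) (add_le_add_right key _)
    field_simp
    push_cast
    ring
  · refine ⟨_, fun t ht => ⟨S.hasDerivWithinAt_covSq p ht, ?_⟩⟩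
    have h1 := (le_abs_self _).trans (abs_raise_le (S.posDef t ht) (shear (g t) (k t)) p)
    rw [hsqrt t ht] at h1
    linarith
  · have hT : tr (g t) (stress m (g t) (f t)) ≤ Q / m ^ 2 * rho m (g t) (f t) := by
      refine tr_stress_le_mul_rho hm (S.posDef t ht) (S.continuous_density ht)
        (S.f_nonneg t ht) (S.integrable t ht) fun p hp => ?_
      rw [S.inCov_eq ht] at hp
      have h1 := hQ ⟨p, hp⟩
      have h2 := covSq_nonneg (S.posDef t ht) p
      have h3 : 0 ≤ Q / m ^ 2 * covSq (g t) p := by positivity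
      rw [energy_sq (S.posDef t ht), mul_add, div_mul_cancel₀ _ (by positivity)]
      simp only at h1
      linarith
    have h1 := tensorSq_nonneg (S.posDef t ht) (shear (g t) (k t))
    have h2 : 4 * Real.pi * rho m (g t) (f t) ≤ H (g t) (k t) ^ 2 / 6 := by
      linarith [S.rho_eq ht]
    have hη := (hH t ht).ne
    rw [div_le_iff₀ (by positivity)]
    calc 4 * Real.pi * tr (g t) (stress m (g t) (f t))
        ≤ 4 * Real.pi * (Q / m ^ 2 * rho m (g t) (f t)) := by gcongr
      _ = Q / m ^ 2 * (4 * Real.pi * rho m (g t) (f t)) := by ring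
      _ ≤ Q / m ^ 2 * (H (g t) (k t) ^ 2 / 6) := by gcongr
      _ = _ := by ring

end IsSolution

theorem covSq_le_sq_of_P_lt {g : Mat} {f : Vec → ℝ} {δ : ℝ} (hδ : 0 < δ)
    (hP : P g f < ENNReal.ofReal δ) {p : Vec} (hp : inCov g f p ≠ 0) : covSq g p ≤ δ ^ 2 := by
  have h1 : ENNReal.ofReal √(covSq g p) ≤ ENNReal.ofReal δ :=
    (le_iSup₂_of_le (f := fun (p : Vec) (_ : inCov g f p ≠ 0) =>
      ENNReal.ofReal √(covSq g p)) p hp le_rfl).trans hP.le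
  rw [ENNReal.ofReal_le_ofReal_iff hδ.le] at h1
  exact (Real.sqrt_le_left hδ.le).1 h1

end BianchiI

end

/-! ### Translation of the rates in `h` into rates in `t`. -/

open BianchiI in
theorem theorem1 (m : ℝ) (hm : 0 < m) :
    ∃ δ : ℝ, 0 < δ ∧
      ∀ (t₀ : ℝ) (g k : ℝ → BianchiI.Mat) (f : ℝ → BianchiI.Vec → ℝ),
        BianchiI.IsSolution m t₀ g k f →
        BianchiI.H (g t₀) (k t₀) ≠ 0 →
        BianchiI.F (g t₀) (k t₀) < δ →
        BianchiI.P (g t₀) (f t₀) < ENNReal.ofReal δ →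
        (∃ r : ℝ → ℝ, r =O[atTop] (fun t : ℝ => t⁻¹) ∧
          ∀ᶠ t : ℝ in atTop, BianchiI.H (g t) (k t) = -2 * t⁻¹ * (1 + r t)) ∧
        (∀ ε : ℝ, 0 < ε → ∃ C : ℝ, ∀ᶠ t : ℝ in atTop,
          BianchiI.P (g t) (f t) ≤ ENNReal.ofReal (C * t ^ (-(2 / 3 : ℝ) + ε))) ∧
        (fun t : ℝ => BianchiI.F (g t) (k t)) =O[atTop] (fun t : ℝ => t ^ (-2 : ℝ)) ∧
        Tendsto (fun t : ℝ => BianchiI.F (g t) (k t)) atTop (𝓝 0) ∧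
        Tendsto (fun t : ℝ => BianchiI.P (g t) (f t)) atTop (𝓝 0) := by
  set δ : ℝ := min (1 / 10000) (m ^ 2 / 10000) with hδdef
  have hδ : 0 < δ := lt_min (by norm_num) (by positivity)
  refine ⟨δ, hδ, fun t₀ g k f S h0 hF hP => ?_⟩
  have R := S.reducedSystem hm h0
  obtain ⟨B, D, E, hD, hE, hdec⟩ := R.decay hm hδ (min_le_left _ _) (min_le_right _ _) hF
    fun p => covSq_le_sq_of_P_lt hδ hP p.2
  -- For `t ≥ 4B` one has `1/h ≥ t/2 - B ≥ t/4`.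
  have hev : ∀ᶠ t : ℝ in atTop, t ∈ Ici t₀ ∧ 1 ≤ t ∧ -H (g t) (k t) ≤ 4 * t⁻¹ := by
    filter_upwards [eventually_ge_atTop t₀, eventually_ge_atTop 1, eventually_ge_atTop (4 * B)]
      with t ht ht1 htB
    refine ⟨ht, ht1, ?_⟩
    have h1 := (abs_le.1 (hdec t ht).1).1
    have h2 := R.h_pos t ht
    have h3 : t / 4 ≤ (-H (g t) (k t))⁻¹ := by linarith
    have h4 := inv_anti₀ (by linarith : 0 < t / 4) h3
    rw [inv_inv] at h4
    refine h4.trans (le_of_eq ?_)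
    rw [inv_div]; ring
  have hFO : (fun t : ℝ => F (g t) (k t)) =O[atTop] (fun t : ℝ => t ^ (-2 : ℝ)) := by
    refine IsBigO.of_bound (E * 16) ?_
    filter_upwards [hev] with t ⟨ht, ht1, hle⟩
    have h1 : 0 ≤ F (g t) (k t) := R.F_nonneg t ht
    have h2 : 0 < -H (g t) (k t) := R.h_pos t ht
    have h3 : t ^ (-2 : ℝ) = t⁻¹ ^ 2 := by
      rw [Real.rpow_neg (by linarith), ← Nat.cast_ofNat, Real.rpow_natCast, inv_pow]
    rw [Real.norm_of_nonneg h1, h3, Real.norm_of_nonneg (sq_nonneg _)]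
    calc F (g t) (k t) ≤ E * (-H (g t) (k t)) ^ 2 := (hdec t ht).2.2
      _ ≤ E * (4 * t⁻¹) ^ 2 := by gcongr
      _ = _ := by ring
  have hPO : ∀ ε : ℝ, 0 < ε → ∃ C : ℝ, ∀ᶠ t : ℝ in atTop,
      P (g t) (f t) ≤ ENNReal.ofReal (C * t ^ (-(2 / 3 : ℝ) + ε)) := by
    intro ε hε
    refine ⟨√D * 4 ^ (2 / 3 : ℝ), ?_⟩
    filter_upwards [hev] with t ⟨ht, ht1, hle⟩
    have h2 : 0 < -H (g t) (k t) := R.h_pos t ht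
    have htpos : 0 < t := by linarith
    refine iSup₂_le fun p hp => ENNReal.ofReal_le_ofReal ?_
    rw [S.inCov_eq ht] at hp
    have h3 : covSq (g t) p ≤ D * (-H (g t) (k t)) ^ (4 / 3 : ℝ) := (hdec t ht).2.1 ⟨p, hp⟩
    have h4 : (-H (g t) (k t)) ^ (4 / 3 : ℝ) = ((-H (g t) (k t)) ^ (2 / 3 : ℝ)) ^ 2 := by
      rw [← Real.rpow_natCast, ← Real.rpow_mul h2.le]; norm_num
    have h5 : √(covSq (g t) p) ≤ √D * (-H (g t) (k t)) ^ (2 / 3 : ℝ) := by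
      refine (Real.sqrt_le_sqrt h3).trans (le_of_eq ?_)
      rw [h4, Real.sqrt_mul' _ (sq_nonneg _), Real.sqrt_sq (Real.rpow_nonneg h2.le _)]
    calc √(covSq (g t) p) ≤ √D * (-H (g t) (k t)) ^ (2 / 3 : ℝ) := h5
      _ ≤ √D * (4 * t⁻¹) ^ (2 / 3 : ℝ) := by gcongr
      _ = √D * 4 ^ (2 / 3 : ℝ) * t ^ (-(2 / 3 : ℝ)) := by
        rw [Real.mul_rpow (by norm_num) (by positivity), Real.inv_rpow htpos.le,
          Real.rpow_neg htpos.le]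
        ring
      -- The preceding line already gives `P = O(t^(-2/3))`; the factor `t^ε ≥ 1` is only a
      -- weakening.
      _ ≤ √D * 4 ^ (2 / 3 : ℝ) * t ^ (-(2 / 3 : ℝ) + ε) := by
        gcongr
        linarith
  -- The remainder is obtained by solving `H = -2 t⁻¹ (1 + r)`; it equals `-h (1/h - t/2)`, a factor
  -- `O(1/t)` times a bounded one.
  refine ⟨⟨fun t => -H (g t) (k t) * t / 2 - 1, ?_, ?_⟩, hPO, hFO, ?_, ?_⟩
  · refine IsBigO.of_bound (4 * B) ?_
    filter_upwards [hev] with t ⟨ht, ht1, hle⟩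
    have h1 := (hdec t ht).1
    have h2 : 0 < -H (g t) (k t) := R.h_pos t ht
    have hB : 0 ≤ B := (abs_nonneg _).trans h1
    have h3 : -H (g t) (k t) * t / 2 - 1
        = -(-H (g t) (k t) * ((-H (g t) (k t))⁻¹ - t / 2)) := by
      rw [mul_sub, mul_inv_cancel₀ h2.ne']; ring
    rw [h3, norm_neg, norm_mul, Real.norm_of_nonneg h2.le, Real.norm_eq_abs,
      Real.norm_of_nonneg (by positivity)]
    calc -H (g t) (k t) * |(-H (g t) (k t))⁻¹ - t / 2| ≤ 4 * t⁻¹ * B := by gcongr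
      _ = _ := by ring
  · filter_upwards [eventually_gt_atTop 0] with t ht
    field_simp
    ring
  · exact hFO.trans_tendsto (tendsto_rpow_neg_atTop (by norm_num))
  · obtain ⟨C, hC⟩ := hPO (1 / 3) (by norm_num)
    have h1 : Tendsto (fun t : ℝ => C * t ^ (-(2 / 3 : ℝ) + 1 / 3)) atTop (𝓝 (C * 0)) := by
      refine Tendsto.const_mul C ?_
      rw [show (-(2 / 3 : ℝ) + 1 / 3) = -(1 / 3) by norm_num]
      exact tendsto_rpow_neg_atTop (by norm_num)
    have h2 := ENNReal.tendsto_ofReal h1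
    rw [mul_zero, ENNReal.ofReal_zero] at h2
    exact tendsto_of_tendsto_of_tendsto_of_le_of_le' tendsto_const_nhds h2
      (Eventually.of_forall fun _ => zero_le) hC
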